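/- **Quadrupole approximation of the Kerr metric in Bondi–Sachs coordinates.** Let $M>0$, $a\in\mathbb R$, and let $\tilde g$ be the Kerr metric in Boyer–Lindquist coordinates $(t,r,\theta,\varphi)$, signature $(+---)$: $$\tilde g=\Big(1-\frac{2Mr}{\Sigma}\Big)dt^2+\frac{4Mar\sin^2\theta}{\Sigma}\,dt\,d\varphi-\frac{\Sigma}{\Delta}dr^2-\Sigma\, d\theta^2-\Big(r^2+a^2+\frac{2Ma^2r\sin^2\theta}{\Sigma}\Big)\sin^2\theta\, d\varphi^2,$$ $\Sigma=r^2+a^2\cos^2\theta$, $\Delta=r^2-2Mr+a^2$. Consider coordinates $(u,r',\theta',\varphi')$ such that $$t=u+r'+2M\ln\Big(\frac{r'}{2M}-1\Big)+\frac{\tau}{r'},\quad r=r'+\frac{\rho}{r'},\quad \theta=\theta'+\frac{\chi}{r'},\quad \varphi=\varphi'+\frac{\psi}{r'},$$ where $\tau,\rho,\chi,\psi$ are functions of $(1/r',\theta')$ that are smooth on $(-\varepsilon,\varepsilon)\times\mathbb R$ for some $\varepsilon>0$. Write $x^A=(\theta',\varphi')$; all $O$'s refer to components in the coordinates $(u,r',\theta',\varphi')$,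 as $r'\to\infty$, and are uniform in $\theta'\in(0,\pi)$, $u$, $\varphi'$. Call the coordinates *approximate Bondi–Sachs coordinates* for $\tilde g$ if $$\tilde g_{u r'}=1+O(r'^{-4}),\qquad \tilde g_{r'r'}=O(r'^{-4}),\qquad \tilde g_{r'A}=O(r'^{-3}),$$ that is, if up to these errors $\tilde g=du(\tilde g_{00}du+2dr'+2\tilde g_{0A}dx^A)+\tilde g_{AB}dx^Adx^B$. Let $s_{AB}$ be the standard metric of $S_2$, $\eta_{AB}$ its Levi-Civita tensor ($\eta_{\theta\varphi}=\sin\theta$), $\nabla_{AB}=\nabla_A\nabla_B-\frac12 s_{AB}\nabla^C\nabla_C$, ${}^*\nabla_{AB}=\eta_A{}^C\nabla_{CB}$, $({}^*dP)_A=\eta_A{}^C\partial_CP$. A metric has mass $m$, angular momentum $J$ and quadrupole potentials $Q^{(2)},P^{(2)}$ (real linear combinations of the spherical harmonics $Y_{2m}$) if it is of this approximate form with $$\tilde g_{00}=1-\frac{2m}{r'}+\frac{6Q^{(2)}}{r'^3}+O(r'^{-4}),\qquad \tilde g_{0A}dx^A=\frac{2J}{r'}\sin^2\theta' d\varphi'+\frac{3}{r'^2}\big(dQ^{(2)}+{}^*dP^{(2)}\big)+O(r'^{-3}),$$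 $$\tilde g_{AB}=-r'^2s_{AB}+\frac{2}{r'}\big(\nabla_{AB}Q^{(2)}+{}^*\nabla_{AB}P^{(2)}\big)+O(r'^{-2}).$$ **Theorem.** Approximate Bondi–Sachs coordinates for the Kerr metric exist, and $\tau,\rho,\psi$ can be chosen even and $2\pi$-periodic, and $\chi$ odd and $2\pi$-periodic, in $\theta'$ (regularity on the sphere). In all approximate Bondi–Sachs coordinates the Kerr metric has unique mass, angular momentum and quadrupole potentials, namely $m=M$, $J=Ma$, $$P^{(2)}=0,\qquad Q^{(2)}=\frac16Ma^2(3\cos^2\theta'-1),$$ and it equals $$du\Big[\Big(1-\frac{2M}{r'}+\frac{3Ma^2}{r'^3}\big(\cos^2\theta'-\tfrac13\big)\Big)du+2dr'+\frac{4Ma}{r'}\sin^2\theta' d\varphi'-\frac{3Ma^2}{r'^2}\sin2\theta' d\theta'\Big]$$ $$-\Big(r'^2+\frac{Ma^2}{r'}\sin^2\theta'\Big)\big(d\theta'^2+\sin^2\theta' d\varphi'^2\big)+\frac{2Ma^2}{r'}\sin^2\theta' d\theta'^2$$ up to errors $O(r'^{-4})$ in the components without an angular index, $O(r'^{-3})$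 in those with one, and $O(r'^{-2})$ in those with two. -/

import Mathlib

open scoped ContDiff

noncomputable section

namespace KerrBS

/-- The Kerr metric with mass `M` and rotation parameter `a` (signature `+---`), as the matrix of
its components at the point with Boyer-Lindquist coordinates `y = (t, r, θ, φ)`. -/
def kerrMetric (M a : ℝ) (y : Fin 4 → ℝ) : Matrix (Fin 4) (Fin 4) ℝ :=
  let r := y 1
  let s := Real.sin (y 2)
  let S := r ^ 2 + a ^ 2 * Real.cos (y 2) ^ 2
  let D := r ^ 2 - 2 * M * r + a ^ 2
  !![1 - 2 * M * r / S, 0, 0, 2 * M * a * r * s ^ 2 / S;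
     0, -(S / D), 0, 0;
     0, 0, -S, 0;
     2 * M * a * r * s ^ 2 / S, 0, 0, -((r ^ 2 + a ^ 2 + 2 * M * a ^ 2 * r * s ^ 2 / S) * s ^ 2)]

/-- Components of the pullback of the metric `g` along `F`:
`g'_{μν}(x) = g_{αβ}(F x) ∂_μ F^α ∂_ν F^β`. -/
def pullback (F : (Fin 4 → ℝ) → (Fin 4 → ℝ)) (g : (Fin 4 → ℝ) → Matrix (Fin 4) (Fin 4) ℝ)
    (x : Fin 4 → ℝ) : Matrix (Fin 4) (Fin 4) ℝ :=
  let J : Matrix (Fin 4) (Fin 4) ℝ :=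
    Matrix.of fun α μ => fderiv ℝ F x (Pi.single μ 1) α
  J.transpose * g (F x) * J

/-- The correction functions, of the two variables `(Ω, θ')` with `Ω = 1 / r'`, in a change of
coordinates between Boyer-Lindquist and retarded coordinates, see `toBL`. -/
structure Corrections where
  t : ℝ → ℝ → ℝ
  r : ℝ → ℝ → ℝ
  θ : ℝ → ℝ → ℝ
  φ : ℝ → ℝ → ℝ

/-- The Boyer-Lindquist coordinates `(t, r, θ, φ)` of the point with coordinates
`x = (u, r', θ', φ')`:
`t = u + r' + 2M ln(r'/2M - 1) + O(1/r')`, `r = r' + O(1/r')`, `θ = θ' + O(1/r')`,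
`φ = φ' + O(1/r')`, where each `O(1/r')` is `1/r'` times a correction function.
In particular `∂_u = ∂_t` and `∂_φ' = ∂_φ`. -/
def toBL (M : ℝ) (c : Corrections) (x : Fin 4 → ℝ) : Fin 4 → ℝ :=
  ![x 0 + x 1 + 2 * M * Real.log (x 1 / (2 * M) - 1) + (x 1)⁻¹ * c.t (x 1)⁻¹ (x 2),
    x 1 + (x 1)⁻¹ * c.r (x 1)⁻¹ (x 2),
    x 2 + (x 1)⁻¹ * c.θ (x 1)⁻¹ (x 2),
    x 3 + (x 1)⁻¹ * c.φ (x 1)⁻¹ (x 2)]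

/-- The corrections are smooth up to (and slightly beyond) scri `Ω = 0`. -/
def Corrections.SmoothAtScri (c : Corrections) : Prop :=
  ∃ ε > 0, ∀ f ∈ [c.t, c.r, c.θ, c.φ],
    ContDiffOn ℝ ∞ (fun p : ℝ × ℝ => f p.1 p.2) (Set.Ioo (-ε) ε ×ˢ Set.univ)

/-- The corrections come from axially symmetric objects on the sphere that are regular at the
poles: three even `2π`-periodic functions of `θ'` and an odd one, the change of the polar angle. -/
def Corrections.RegularOnSphere (c : Corrections) : Prop :=
  ∀ w θ : ℝ,
    (c.t w (-θ) = c.t w θ ∧ c.t w (θ + 2 * Real.pi) = c.t w θ) ∧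
    (c.r w (-θ) = c.r w θ ∧ c.r w (θ + 2 * Real.pi) = c.r w θ) ∧
    (c.θ w (-θ) = -c.θ w θ ∧ c.θ w (θ + 2 * Real.pi) = c.θ w θ) ∧
    (c.φ w (-θ) = c.φ w θ ∧ c.φ w (θ + 2 * Real.pi) = c.φ w θ)

/-- `f = O(r^{-n})` as `r → ∞`, uniformly in the other coordinates of `x = (u, r, θ, φ)`
with `0 < θ < π`. -/
def IsO (n : ℕ) (f : (Fin 4 → ℝ) → ℝ) : Prop :=
  ∃ C R : ℝ, 0 < R ∧ ∀ x : Fin 4 → ℝ, R ≤ x 1 → x 2 ∈ Set.Ioo 0 Real.pi →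
    |f x| ≤ C * (x 1)⁻¹ ^ n

/-- The order of the first terms beyond the quadrupole ones in the components of a metric in the
coordinates `(u, r, θ, φ)`: each angular index costs one power of `1/r`. -/
def beyondQuadrupole : Matrix (Fin 4) (Fin 4) ℕ :=
  !![4, 4, 3, 3; 4, 4, 3, 3; 3, 3, 2, 2; 3, 3, 2, 2]

/-- The two metrics agree up to and including the quadrupole terms. -/
def AgreeToQuadrupole (g h : (Fin 4 → ℝ) → Matrix (Fin 4) (Fin 4) ℝ) : Prop :=
  ∀ μ ν : Fin 4, IsO (beyondQuadrupole μ ν) fun x => g x μ ν - h x μ ν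

/-- The metric `g` has, in the coordinates `(u, r, x^A)`, the Bondi-Sachs form (affine gauge)
`du (g_00 du + 2 dr + 2 g_0A dx^A) + g_AB dx^A dx^B`, i.e. `g_01 = 1`, `g_11 = g_1A = 0`,
up to terms beyond the quadrupole order. -/
def IsApproxBondiSachsForm (g : (Fin 4 → ℝ) → Matrix (Fin 4) (Fin 4) ℝ) : Prop :=
  ∀ ν : Fin 4, IsO (beyondQuadrupole 1 ν) fun x => g x 1 ν - if ν = 0 then 1 else 0

/-- The Kerr metric in the coordinates `(u, r', θ', φ')` defined by the corrections `c`. -/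
def kerrIn (M a : ℝ) (c : Corrections) : (Fin 4 → ℝ) → Matrix (Fin 4) (Fin 4) ℝ :=
  pullback (toBL M c) (kerrMetric M a)

/-- `c` defines approximate Bondi-Sachs coordinates for the Kerr metric. -/
def IsApproxBondiSachsChart (M a : ℝ) (c : Corrections) : Prop :=
  c.SmoothAtScri ∧ IsApproxBondiSachsForm (kerrIn M a c)

/-! Differential operators on the unit sphere, in the coordinates `x^A = (θ, φ)`. -/

/-- The standard metric `s_AB`. -/
def sphMetric (θ : ℝ) : Matrix (Fin 2) (Fin 2) ℝ := !![1, 0; 0, Real.sin θ ^ 2]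

/-- The Levi-Civita tensor `η_A^C` (from `η_θφ = sin θ`). -/
def sphEta (θ : ℝ) : Matrix (Fin 2) (Fin 2) ℝ := !![0, 1 / Real.sin θ; -Real.sin θ, 0]

def pθ (f : ℝ → ℝ → ℝ) (θ φ : ℝ) : ℝ := deriv (fun z => f z φ) θ

def pφ (f : ℝ → ℝ → ℝ) (θ φ : ℝ) : ℝ := deriv (fun z => f θ z) φ

/-- `∂_A f`. -/
def sphGrad (f : ℝ → ℝ → ℝ) (θ φ : ℝ) : Fin 2 → ℝ := ![pθ f θ φ, pφ f θ φ]

/-- `∇_A ∇_B f`. -/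
def sphHess (f : ℝ → ℝ → ℝ) (θ φ : ℝ) : Matrix (Fin 2) (Fin 2) ℝ :=
  let m := pθ (pφ f) θ φ - Real.cos θ / Real.sin θ * pφ f θ φ
  !![pθ (pθ f) θ φ, m;
     m, pφ (pφ f) θ φ + Real.sin θ * Real.cos θ * pθ f θ φ]

/-- The Laplace operator `Δ f = s^{AB} ∇_A ∇_B f`. -/
def sphLap (f : ℝ → ℝ → ℝ) (θ φ : ℝ) : ℝ :=
  sphHess f θ φ 0 0 + sphHess f θ φ 1 1 / Real.sin θ ^ 2

/-- `∇_AB f = ∇_A ∇_B f - (1/2) s_AB Δ f`. -/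
def sphTF (f : ℝ → ℝ → ℝ) (θ φ : ℝ) : Matrix (Fin 2) (Fin 2) ℝ :=
  sphHess f θ φ - (sphLap f θ φ / 2) • sphMetric θ

/-- `*d f`, with components `η_A^C ∂_C f`. -/
def starGrad (f : ℝ → ℝ → ℝ) (θ φ : ℝ) : Fin 2 → ℝ := (sphEta θ).mulVec (sphGrad f θ φ)

/-- `*∇_AB f = η_A^C ∇_CB f`. -/
def starTF (f : ℝ → ℝ → ℝ) (θ φ : ℝ) : Matrix (Fin 2) (Fin 2) ℝ := sphEta θ * sphTF f θ φ

/-- `f` is a real linear combination of the spherical harmonics `Y_{2m}`, i.e. the restriction to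
the unit sphere of the quadratic form of a symmetric trace-free matrix. -/
def IsQuadrupoleHarmonic (f : ℝ → ℝ → ℝ) : Prop :=
  ∃ S : Matrix (Fin 3) (Fin 3) ℝ, S.IsSymm ∧ S.trace = 0 ∧ ∀ θ φ : ℝ,
    let n : Fin 3 → ℝ :=
      ![Real.sin θ * Real.cos φ, Real.sin θ * Real.sin φ, Real.cos θ]
    f θ φ = n ⬝ᵥ S.mulVec n

/-- The stationary Bondi-Sachs metric with mass `m`, angular momentum `J` about the axis `θ = 0`
and quadrupole potentials `Q`, `P` (mass and spin), cut off after the quadrupole terms: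
`g_00 = 1 - 2m/r + 6Q/r³`, `g_0A dx^A = (2J/r) sin²θ dφ + (3/r²) (dQ + *dP)`,
`g_AB = -r² s_AB + (2/r) (∇_AB Q + *∇_AB P)`. -/
def quadrupoleMetric (m J : ℝ) (Q P : ℝ → ℝ → ℝ) (x : Fin 4 → ℝ) :
    Matrix (Fin 4) (Fin 4) ℝ :=
  let r := x 1
  let g00 := 1 - 2 * m / r + 6 * Q (x 2) (x 3) / r ^ 3
  let v : Fin 2 → ℝ := (2 * J / r) • ![0, Real.sin (x 2) ^ 2] +
    (3 / r ^ 2) • (sphGrad Q (x 2) (x 3) + starGrad P (x 2) (x 3))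
  let h : Matrix (Fin 2) (Fin 2) ℝ := -(r ^ 2) • sphMetric (x 2) +
    (2 / r) • (sphTF Q (x 2) (x 3) + starTF P (x 2) (x 3))
  !![g00, 1, v 0, v 1;
     1, 0, 0, 0;
     v 0, 0, h 0 0, h 0 1;
     v 1, 0, h 1 0, h 1 1]

/-- `g` has mass `m`, angular momentum `J` and quadrupole potentials `Q^(2) = Q`, `P^(2) = P`. -/
def HasQuadrupole (g : (Fin 4 → ℝ) → Matrix (Fin 4) (Fin 4) ℝ) (m J : ℝ) (Q P : ℝ → ℝ → ℝ) :
    Prop :=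
  IsQuadrupoleHarmonic Q ∧ IsQuadrupoleHarmonic P ∧ AgreeToQuadrupole g (quadrupoleMetric m J Q P)

/-- The explicit metric
`du [(1 - 2M/r + (3Ma²/r³)(cos²θ - 1/3)) du + 2 dr + (4Ma/r) sin²θ dφ - (3Ma²/r²) sin 2θ dθ]`
`- (r² + (Ma²/r) sin²θ) (dθ² + sin²θ dφ²) + (2Ma²/r) sin²θ dθ²`. -/
def kerrQuadrupole (M a : ℝ) (x : Fin 4 → ℝ) : Matrix (Fin 4) (Fin 4) ℝ :=
  let r := x 1
  let s := Real.sin (x 2)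
  let g00 := 1 - 2 * M / r + 3 * M * a ^ 2 / r ^ 3 * (Real.cos (x 2) ^ 2 - 1 / 3)
  let g02 := -(3 * M * a ^ 2 / (2 * r ^ 2) * Real.sin (2 * x 2))
  let g03 := 2 * M * a / r * s ^ 2
  let k := r ^ 2 + M * a ^ 2 / r * s ^ 2
  !![g00, 1, g02, g03;
     1, 0, 0, 0;
     g02, 0, -k + 2 * M * a ^ 2 / r * s ^ 2, 0;
     g03, 0, 0, -(k * s ^ 2)]

end KerrBS

end

noncomputable section

namespace KerrBS

open Set Filter Topology Asymptotics

/-! Put `w = 1 / r'`. The Kerr coefficients do not involve `t` and `φ`, and the logarithm enters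
only through its derivative, `r' + 2M ln(r'/2M - 1)` having slope `(1 - 2 * M * w)⁻¹`. Hence all
components in the new coordinates, the angular block multiplied by `w ^ 2`, are explicit functions
of `(w, θ')` (`scaling_mul_kerrIn`), and every condition is an estimate of order at most `w ^ 4`,
uniform in `θ'`. Only the first Taylor coefficients in `w` of `τ, ρ, χ, ψ` matter.

Expansions become algebra: the functions bounded near `w = 0` form a ring, those of order `O(w ^ 4)`
an ideal, and in the quotient `ScriRing` the class `W` of `w` satisfies `W ^ 4 = 0`. The expansions
are then identities valid in any commutative ring (`leading_algebra`, `expansion_algebra`).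

The lowest orders of the components `r'θ'`, `ur'`, `r'φ'` force `χ₀ = τ₀ = ψ₀ = 0`. After that the
Bondi-Sachs conditions are a triangular system with exactly one solution for `ρ₀, τ₁, ρ₁, χ₁, χ₂,
ψ₁, ψ₂` (`isBondiSachs_of_isApproxBondiSachsForm`). Conversely these values suffice, and the
polynomials in `w` with these coefficients give a regular chart. The other components depend, to the
required order, on these coefficients only, so every chart yields the same truncated metric.

Finally this metric is `quadrupoleMetric` with the claimed data, and the data are unique
(`quadrupole_unique`): `g_00` determines `m` and `Q`, then `g_0A` determines `J` and the gradient of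
`P`; a quadrupole harmonic that is constant vanishes. -/

/-! ### Taylor expansion in `w` with smooth remainder. -/

theorem contDiff_nat_parametric_integral {E : Type} [NormedAddCommGroup E] [NormedSpace ℝ E]
    [ProperSpace E] (n : ℕ) : ∀ {F : Type} [NormedAddCommGroup F] [NormedSpace ℝ F]
    [CompleteSpace F] {H : E × ℝ → F}, ContDiff ℝ ∞ H →
    ContDiff ℝ n fun x => ∫ s in (0 : ℝ)..1, H (x, s) := by
  -- The induction keeps `F` general, because the derivative of the integral is an integral with
  -- values in `E →L[ℝ] F`.
  induction n with
  | zero =>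
    intro F _ _ _ H hH
    exact contDiff_zero.2 (intervalIntegral.continuous_parametric_intervalIntegral_of_continuous'
      (f := fun x s => H (x, s)) hH.continuous 0 1)
  | succ n ih =>
    intro F _ _ _ H hH
    have hD : ContDiff ℝ ∞ fun p : E × ℝ =>
        (fderiv ℝ H p).comp (ContinuousLinearMap.inl ℝ E ℝ) :=
      (hH.fderiv_right (m := ∞) (by simp)).clm_comp contDiff_const
    push_cast
    refine contDiff_succ_iff_hasFDerivAt.2 ⟨_, ih hD, fun x => ?_⟩
    obtain ⟨C, hC⟩ := ((isCompact_closedBall x 1).prod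
      (isCompact_Icc (a := (0 : ℝ)) (b := 1))).exists_bound_of_continuousOn
      hD.continuous.continuousOn
    refine intervalIntegral.hasFDerivAt_integral_of_dominated_of_fderiv_le
      (𝕜 := ℝ) (s := Metric.ball x 1) (bound := fun _ => C)
      (F := fun x s => H (x, s)) (a := 0) (b := 1) (μ := MeasureTheory.volume)
      (F' := fun x s => (fderiv ℝ H (x, s)).comp (ContinuousLinearMap.inl ℝ E ℝ))
      (Metric.ball_mem_nhds x one_pos) ?_ ?_ ?_ ?_ ?_ ?_
    · exact .of_forall fun y => (hH.continuous.comp (Continuous.prodMk_right y)).aestronglyMeasurable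
    · exact (hH.continuous.comp (Continuous.prodMk_right x)).intervalIntegrable 0 1
    · exact (hD.continuous.comp (Continuous.prodMk_right x)).aestronglyMeasurable
    · refine .of_forall fun s hs y hy => hC (y, s) ⟨Metric.ball_subset_closedBall hy, ?_⟩
      rw [uIoc_of_le zero_le_one] at hs
      exact Ioc_subset_Icc_self hs
    · exact intervalIntegrable_const
    · refine .of_forall fun s _ y _ => ?_
      exact ((hH.differentiable (by simp)) (y, s)).hasFDerivAt.comp y (hasFDerivAt_prodMk_left y s)

/-- Hadamard's lemma: `g (w, θ)` is the integral over `s ∈ [0, 1]` of `∂_w f (s * w, θ)`, smooth by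
differentiation under the integral sign. -/
theorem exists_smooth_eq_add_mul {f : ℝ × ℝ → ℝ} (hf : ContDiff ℝ ∞ f) :
    ∃ g : ℝ × ℝ → ℝ, ContDiff ℝ ∞ g ∧ ∀ w θ, f (w, θ) = f (0, θ) + w * g (w, θ) := by
  have hD : ContDiff ℝ ∞ fun p : (ℝ × ℝ) × ℝ =>
      fderiv ℝ f (p.2 * p.1.1, p.1.2) (1, 0) :=
    ((hf.fderiv_right (m := ∞) (by simp)).comp (by fun_prop)).clm_apply contDiff_const
  refine ⟨_, contDiff_infty.2 fun n => contDiff_nat_parametric_integral n hD, fun w θ => ?_⟩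
  have key : ∀ s : ℝ, HasDerivAt (fun s => f (s * w, θ))
      (w * fderiv ℝ f (s * w, θ) (1, 0)) s := fun s => by
    have h1 : HasDerivAt (fun s : ℝ => (s * w, θ)) (w, 0) s := by
      simpa using ((hasDerivAt_id s).mul_const w).prodMk (hasDerivAt_const s θ)
    have h2 := ((hf.differentiable (by simp)) (s * w, θ)).hasFDerivAt.comp_hasDerivAt s h1
    have h3 : ((w, 0) : ℝ × ℝ) = w • (1, 0) := by simp
    rw [h3, map_smul, smul_eq_mul] at h2
    exact h2
  have hc : Continuous fun s : ℝ => w * fderiv ℝ f (s * w, θ) (1, 0) :=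
    continuous_const.mul (hD.continuous.comp (Continuous.prodMk_right (w, θ)))
  have := intervalIntegral.integral_eq_sub_of_hasDerivAt (a := 0) (b := 1)
    (fun s _ => key s) (hc.intervalIntegrable _ _)
  rw [intervalIntegral.integral_const_mul] at this
  simp only [one_mul, zero_mul] at this
  linarith

/-- A smooth function of `(w, θ)` together with its Taylor expansion in `w` of order three. -/
structure Jet where
  c0 : ℝ → ℝ
  c1 : ℝ → ℝ
  c2 : ℝ → ℝ
  c3 : ℝ → ℝ
  rem : ℝ × ℝ → ℝ
  smooth0 : ContDiff ℝ ∞ c0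
  smooth1 : ContDiff ℝ ∞ c1
  smooth2 : ContDiff ℝ ∞ c2
  smooth3 : ContDiff ℝ ∞ c3
  smoothRem : ContDiff ℝ ∞ rem

namespace Jet

def val (j : Jet) (w θ : ℝ) : ℝ :=
  j.c0 θ + w * j.c1 θ + w ^ 2 * j.c2 θ + w ^ 3 * j.c3 θ + w ^ 4 * j.rem (w, θ)

theorem contDiff_val (j : Jet) : ContDiff ℝ ∞ fun p : ℝ × ℝ => j.val p.1 p.2 := by
  have := j.smooth0; have := j.smooth1; have := j.smooth2; have := j.smooth3
  have := j.smoothRem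
  unfold val
  fun_prop

end Jet

theorem exists_jet {f : ℝ → ℝ → ℝ} {ε : ℝ} (hε : 0 < ε)
    (hf : ContDiffOn ℝ ∞ (fun p : ℝ × ℝ => f p.1 p.2) (Ioo (-ε) ε ×ˢ univ)) :
    ∃ j : Jet, ∀ w θ, |w| ≤ ε / 2 → f w θ = j.val w θ := by
  -- The map `w ↦ w * b w` takes values in `(-ε, ε)` and is the identity for `|w| ≤ ε / 2`.
  -- Precomposing with it gives a globally smooth function, to which Hadamard's lemma applies four
  -- times.
  let b : ContDiffBump (0 : ℝ) := ⟨ε / 2, ε, by positivity, by linarith⟩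
  have hb : ContDiff ℝ ∞ b := b.contDiff
  have hmem : ∀ w, w * b w ∈ Ioo (-ε) ε := fun w => by
    rw [mem_Ioo, ← abs_lt, abs_mul, abs_of_nonneg b.nonneg]
    rcases lt_or_ge |w| ε with h | h
    · exact (mul_le_of_le_one_right (abs_nonneg w) b.le_one).trans_lt h
    · rw [b.zero_of_le_dist (by simpa [Real.dist_eq] using h), mul_zero]; exact hε
  have hF : ContDiff ℝ ∞ fun p : ℝ × ℝ => f (p.1 * b p.1) p.2 := by
    rw [← contDiffOn_univ]
    exact hf.comp (t := Ioo (-ε) ε ×ˢ univ) (f := fun p : ℝ × ℝ => (p.1 * b p.1, p.2))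
      (ContDiff.contDiffOn (by fun_prop)) (fun p _ => ⟨hmem p.1, trivial⟩)
  obtain ⟨g1, h1, e1⟩ := exists_smooth_eq_add_mul hF
  obtain ⟨g2, h2, e2⟩ := exists_smooth_eq_add_mul h1
  obtain ⟨g3, h3, e3⟩ := exists_smooth_eq_add_mul h2
  obtain ⟨g4, h4, e4⟩ := exists_smooth_eq_add_mul h3
  have hs : ∀ {g : ℝ × ℝ → ℝ}, ContDiff ℝ ∞ g → ContDiff ℝ ∞ fun θ => g (0, θ) :=
    fun hg => by fun_prop
  refine ⟨⟨_, _, _, _, g4, hs hF, hs h1, hs h2, hs h3, h4⟩, fun w θ hw => ?_⟩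
  have hw1 : b w = 1 := b.one_of_mem_closedBall (by simpa [Real.dist_eq] using hw)
  have := e1 w θ
  simp only [hw1, mul_one] at this
  rw [this, e2, e3, e4]
  simp only [Jet.val]
  ring

/-! ### Order estimates near scri, uniform in `θ`. -/

/-- The filter of points `(w, θ)` with `0 < θ < π` and `w → 0` from above. -/
def nearScri : Filter (ℝ × ℝ) := 𝓝[>] 0 ×ˢ 𝓟 (Ioo 0 Real.pi)

theorem eventually_nearScri {δ : ℝ} (hδ : 0 < δ) :
    ∀ᶠ p in nearScri, 0 < p.1 ∧ p.1 < δ ∧ p.2 ∈ Ioo 0 Real.pi := by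
  have h : Ioo 0 δ ×ˢ Ioo 0 Real.pi ∈ nearScri :=
    prod_mem_prod (Ioo_mem_nhdsGT hδ) (mem_principal_self _)
  filter_upwards [h] with p hp using ⟨hp.1.1, hp.1.2, hp.2⟩

theorem tendsto_slice {θ : ℝ} (hθ : θ ∈ Ioo 0 Real.pi) :
    Tendsto (fun w : ℝ => (w, θ)) (𝓝[>] 0) nearScri :=
  tendsto_id.prodMk (tendsto_principal.2 (.of_forall fun _ => hθ))

theorem isBigO_one_of_continuous {f : ℝ × ℝ → ℝ} (hf : Continuous f) :
    f =O[nearScri] fun _ => (1 : ℝ) := by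
  obtain ⟨C, hC⟩ := ((isCompact_Icc (a := (0 : ℝ)) (b := 1)).prod
    (isCompact_Icc (a := (0 : ℝ)) (b := Real.pi))).exists_bound_of_continuousOn hf.continuousOn
  refine IsBigO.of_bound C ?_
  filter_upwards [eventually_nearScri one_pos] with p hp
  simpa using hC p ⟨⟨hp.1.le, hp.2.1.le⟩, Ioo_subset_Icc_self hp.2.2⟩

theorem isBigO_fst_pow_mul {f g : ℝ × ℝ → ℝ} {m n : ℕ}
    (hf : f =O[nearScri] fun p => p.1 ^ m) (hg : g =O[nearScri] fun p => p.1 ^ n) :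
    (fun p => f p * g p) =O[nearScri] fun p => p.1 ^ (m + n) := by
  simpa [pow_add] using hf.mul hg

theorem isBigO_fst_pow_of_le {f : ℝ × ℝ → ℝ} {m n : ℕ} (hmn : m ≤ n)
    (hf : f =O[nearScri] fun p => p.1 ^ n) : f =O[nearScri] fun p => p.1 ^ m := by
  refine hf.trans (IsBigO.of_bound 1 ?_)
  filter_upwards [eventually_nearScri one_pos] with p hp
  rw [one_mul, norm_pow, norm_pow, Real.norm_of_nonneg hp.1.le]
  exact pow_le_pow_of_le_one hp.1.le hp.2.1.le hmn

theorem isBigO_of_fst_pow_mul {f : ℝ × ℝ → ℝ} {m n : ℕ}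
    (hf : (fun p => p.1 ^ m * f p) =O[nearScri] fun p => p.1 ^ (m + n)) :
    f =O[nearScri] fun p => p.1 ^ n := by
  have h := (isBigO_refl (fun p : ℝ × ℝ => (p.1 ^ m)⁻¹) nearScri).mul hf
  refine (h.congr' ?_ ?_)
  all_goals
    filter_upwards [eventually_nearScri one_pos] with p hp
    have := hp.1.ne'
    field_simp
  ring

/-! ### The ring of bounded functions modulo `O(w^4)`. -/

/-- The functions that are bounded near scri. -/
def bddRing : Subring (ℝ × ℝ → ℝ) where
  carrier := {f | f =O[nearScri] fun _ => (1 : ℝ)}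
  mul_mem' hf hg := by simpa using hf.mul hg
  one_mem' := isBigO_refl _ _
  add_mem' hf hg := hf.add hg
  zero_mem' := isBigO_zero _ _
  neg_mem' hf := hf.neg_left

/-- The ideal of the functions of order `O(w^4)`. -/
def orderFour : Ideal bddRing where
  carrier := {f | f.1 =O[nearScri] fun p => p.1 ^ 4}
  add_mem' hf hg := hf.add hg
  zero_mem' := isBigO_zero _ _
  smul_mem' c f hf := by
    have h := IsBigO.mul c.2 hf
    simp only [one_mul] at h
    exact h

/-- The functions bounded near scri, modulo `O(w^4)`. -/
abbrev ScriRing : Type := bddRing ⧸ orderFour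

/-- `f` is bounded near scri, and `k` is its class modulo `O(w^4)`. -/
def Rep (f : ℝ × ℝ → ℝ) (k : ScriRing) : Prop :=
  ∃ h : f ∈ bddRing, Ideal.Quotient.mk orderFour ⟨f, h⟩ = k

namespace Rep

variable {f g : ℝ × ℝ → ℝ} {k l : ScriRing}

theorem exists_of_isBigO (h : f =O[nearScri] fun _ => (1 : ℝ)) : ∃ k, Rep f k := ⟨_, h, rfl⟩

theorem exists_of_continuous (h : Continuous f) : ∃ k, Rep f k :=
  exists_of_isBigO (isBigO_one_of_continuous h)

theorem add (hf : Rep f k) (hg : Rep g l) : Rep (fun p => f p + g p) (k + l) := by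
  obtain ⟨h, rfl⟩ := hf
  obtain ⟨h', rfl⟩ := hg
  exact ⟨bddRing.add_mem h h', rfl⟩

theorem sub (hf : Rep f k) (hg : Rep g l) : Rep (fun p => f p - g p) (k - l) := by
  obtain ⟨h, rfl⟩ := hf
  obtain ⟨h', rfl⟩ := hg
  exact ⟨bddRing.sub_mem h h', rfl⟩

theorem neg (hf : Rep f k) : Rep (fun p => -f p) (-k) := by
  obtain ⟨h, rfl⟩ := hf
  exact ⟨bddRing.neg_mem h, rfl⟩

theorem mul (hf : Rep f k) (hg : Rep g l) : Rep (fun p => f p * g p) (k * l) := by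
  obtain ⟨h, rfl⟩ := hf
  obtain ⟨h', rfl⟩ := hg
  exact ⟨bddRing.mul_mem h h', rfl⟩

theorem pow (hf : Rep f k) (n : ℕ) : Rep (fun p => f p ^ n) (k ^ n) := by
  obtain ⟨h, rfl⟩ := hf
  exact ⟨bddRing.pow_mem h n, rfl⟩

theorem one : Rep (fun _ => 1) 1 := ⟨bddRing.one_mem, rfl⟩

theorem zero : Rep (fun _ => 0) 0 := ⟨bddRing.zero_mem, rfl⟩

theorem ofNat (n : ℕ) [n.AtLeastTwo] : Rep (fun _ => OfNat.ofNat n) (OfNat.ofNat n) :=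
  ⟨natCast_mem bddRing n, rfl⟩

theorem bdd (hf : Rep f k) : f =O[nearScri] fun _ => (1 : ℝ) := hf.1

/-- The bridge between algebra and analysis: equality in `ScriRing` is an estimate of order `w ^ 4`.
-/
theorem eq_iff (hf : Rep f k) (hg : Rep g l) :
    k = l ↔ (fun p => f p - g p) =O[nearScri] fun p => p.1 ^ 4 := by
  obtain ⟨h, rfl⟩ := hf
  obtain ⟨h', rfl⟩ := hg
  exact Ideal.Quotient.eq

theorem congr (hf : Rep f k) (h : f =ᶠ[nearScri] g) : Rep g k := by
  obtain ⟨l, hg⟩ := exists_of_isBigO (hf.bdd.congr' h EventuallyEq.rfl)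
  have : k = l := (hf.eq_iff hg).2 (IsBigO.of_bound 1 (h.mono fun p hp => by simp [hp]))
  exact this ▸ hg

theorem eq_of_eventuallyEq (hf : Rep f k) (hg : Rep g l) (h : f =ᶠ[nearScri] g) : k = l :=
  (hf.eq_iff hg).2 (IsBigO.of_bound 1 (h.mono fun p hp => by simp [hp]))

theorem pow_fst {w : ScriRing} (hw : Rep Prod.fst w) : w ^ 4 = 0 :=
  ((hw.pow 4).eq_iff zero).2 (by simpa using isBigO_refl _ _)

/-- The inverse of a continuous function which is one on scri. -/
theorem exists_inv (hf : Continuous f) (h1 : ∀ θ, f (0, θ) = 1) (hk : Rep f k) :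
    (∀ᶠ p in nearScri, f p ≠ 0) ∧ ∃ l, Rep (fun p => (f p)⁻¹) l ∧ k * l = 1 := by
  -- Compactness of `[0, π]` makes the lower bound uniform in `θ`, so the inverse is bounded by 2
  -- near scri.
  have hU : ∀ᶠ w in 𝓝 (0 : ℝ), ∀ θ ∈ Icc 0 Real.pi, (1 : ℝ) / 2 < f (w, θ) := by
    have := isCompact_Icc.eventually_forall_of_forall_eventually (x₀ := (0 : ℝ))
      (K := Icc 0 Real.pi) (P := fun w θ => (1 : ℝ) / 2 < f (w, θ)) (fun θ _ => ?_)
    · exact this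
    · exact hf.continuousAt.eventually_const_lt (by rw [h1]; norm_num)
  obtain ⟨δ, hδ, hU⟩ := Metric.eventually_nhds_iff.1 hU
  have hU' : ∀ᶠ p in nearScri, (1 : ℝ) / 2 < f p := by
    filter_upwards [eventually_nearScri hδ] with p hp
    refine hU (y := p.1) ?_ p.2 (Ioo_subset_Icc_self hp.2.2)
    rw [Real.dist_eq, sub_zero, abs_of_pos hp.1]
    exact hp.2.1
  have hne : ∀ᶠ p in nearScri, f p ≠ 0 := hU'.mono fun p hp => by linarith
  refine ⟨hne, ?_⟩
  obtain ⟨l, hl⟩ := exists_of_isBigO (f := fun p => (f p)⁻¹) (by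
    refine IsBigO.of_bound 2 ?_
    filter_upwards [hU'] with p hp
    rw [norm_inv, norm_one, mul_one, Real.norm_of_nonneg (by linarith)]
    exact inv_le_of_inv_le₀ (by norm_num) (by linarith))
  exact ⟨l, hl, (hk.mul hl).eq_of_eventuallyEq one (hne.mono fun p hp => mul_inv_cancel₀ hp)⟩

end Rep

/-! ### Extracting Taylor coefficients from order estimates. -/

/-- The limit `w → 0` gives `α = 0`; dividing by `w` then lowers the order by one. Iterated on a
polynomial in Horner form, this peels off its coefficients one at a time. -/
theorem eq_zero_of_isBigO_pow {α : ℝ} {g : ℝ → ℝ} {n : ℕ} (hg : Continuous g)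
    (h : (fun w => α + w * g w) =O[𝓝[>] 0] fun w => w ^ (n + 1)) :
    α = 0 ∧ g =O[𝓝[>] 0] fun w => w ^ n := by
  have hα : α = 0 := by
    have h1 : Tendsto (fun w => α + w * g w) (𝓝[>] 0) (𝓝 0) :=
      h.trans_tendsto (tendsto_nhdsWithin_of_tendsto_nhds
        (by simpa using (continuous_pow (n + 1)).tendsto (0 : ℝ)))
    have h2 : Tendsto (fun w => α + w * g w) (𝓝[>] 0) (𝓝 α) :=
      tendsto_nhdsWithin_of_tendsto_nhds
        (by simpa using (show Continuous fun w => α + w * g w by fun_prop).tendsto (0 : ℝ))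
    exact tendsto_nhds_unique h2 h1
  refine ⟨hα, ?_⟩
  have h3 := (isBigO_refl (fun w : ℝ => w⁻¹) (𝓝[>] 0)).mul h
  refine h3.congr' ?_ ?_
  all_goals
    filter_upwards [self_mem_nhdsWithin] with w hw
    have : w ≠ 0 := (mem_Ioi.1 hw).ne'
    field_simp
  · simp [hα]
  · ring

theorem coeff_eq_zero {α0 α1 α2 α3 : ℝ → ℝ} {n : ℕ}
    (h : (fun p : ℝ × ℝ => α0 p.2 + p.1 * (α1 p.2 + p.1 * (α2 p.2 + p.1 * α3 p.2)))
      =O[nearScri] fun p => p.1 ^ n) {θ : ℝ} (hθ : θ ∈ Ioo 0 Real.pi) :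
    (1 ≤ n → α0 θ = 0) ∧ (2 ≤ n → α1 θ = 0) ∧ (3 ≤ n → α2 θ = 0) ∧ (4 ≤ n → α3 θ = 0) := by
  have h0 : (fun w => α0 θ + w * (α1 θ + w * (α2 θ + w * α3 θ)))
      =O[𝓝[>] (0 : ℝ)] fun w => w ^ n := h.comp_tendsto (tendsto_slice hθ)
  rcases n with _ | n
  · simp
  obtain ⟨e0, h1⟩ := eq_zero_of_isBigO_pow (by fun_prop) h0
  rcases n with _ | n
  · simp [e0]
  obtain ⟨e1, h2⟩ := eq_zero_of_isBigO_pow (by fun_prop) h1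
  rcases n with _ | n
  · simp [e0, e1]
  obtain ⟨e2, h3⟩ := eq_zero_of_isBigO_pow (by fun_prop) h2
  rcases n with _ | n
  · simp [e0, e1, e2]
  obtain ⟨e3, -⟩ := eq_zero_of_isBigO_pow (g := fun _ => 0) (α := α3 θ) (by fun_prop)
    (by simpa using h3)
  simp [e0, e1, e2, e3]

/-- Both sides are uniform bounds over `0 < θ < π`. A function of `(1 / r', θ')` only can be tested
at `u = φ' = 0`, and its bound holds for all `u` and `φ'`. -/
theorem isO_iff_isBigO {n : ℕ} {f : (Fin 4 → ℝ) → ℝ} {F : ℝ × ℝ → ℝ} {R₀ : ℝ}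
    (h : ∀ x : Fin 4 → ℝ, R₀ ≤ x 1 → 0 < x 1 → x 2 ∈ Ioo 0 Real.pi → f x = F ((x 1)⁻¹, x 2)) :
    IsO n f ↔ F =O[nearScri] fun p => p.1 ^ n := by
  constructor
  · rintro ⟨C, R, hR, hC⟩
    refine IsBigO.of_bound C ?_
    have hm : 0 < max R R₀ := lt_max_of_lt_left hR
    filter_upwards [eventually_nearScri (inv_pos.2 hm)] with p hp
    have h1 : max R R₀ ≤ p.1⁻¹ := by
      rw [le_inv_comm₀ hm hp.1]; exact hp.2.1.le
    have h2 := hC ![0, p.1⁻¹, p.2, 0] ((le_max_left _ _).trans h1) hp.2.2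
    rw [h _ ((le_max_right _ _).trans h1) (by simpa using hp.1) hp.2.2] at h2
    simpa [abs_of_pos hp.1] using h2
  · intro hF
    obtain ⟨C, hC⟩ := hF.bound
    obtain ⟨U, hU, V, hV, hUV⟩ := mem_prod_iff.1 hC
    obtain ⟨δ, hδ, hδU⟩ := mem_nhdsGT_iff_exists_Ioo_subset.1 hU
    rw [mem_principal] at hV
    have hδ' : 0 < δ := hδ
    refine ⟨C, max R₀ (2 * δ⁻¹), lt_max_of_lt_right (by positivity), fun x hx hθ => ?_⟩
    have h1 : 2 * δ⁻¹ ≤ x 1 := (le_max_right _ _).trans hx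
    have h2 : 0 < δ⁻¹ := inv_pos.2 hδ'
    have h3 : 0 < x 1 := by linarith
    have h4 : (x 1)⁻¹ < δ := by
      rw [inv_lt_comm₀ h3 hδ']; linarith
    have h5 := hUV (show ((x 1)⁻¹, x 2) ∈ U ×ˢ V from ⟨hδU ⟨by simpa using h3, h4⟩, hV hθ⟩)
    rw [h x ((le_max_left _ _).trans hx) h3 hθ]
    simpa [abs_of_pos h3] using h5

/-! ### The Jacobian of the change of coordinates. -/

namespace Jet

/-- `∂_w (w f)` for the function `f` given by the jet. -/
def hat (j : Jet) (w θ : ℝ) : ℝ :=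
  j.c0 θ + 2 * w * j.c1 θ + 3 * w ^ 2 * j.c2 θ + 4 * w ^ 3 * j.c3 θ +
    w ^ 4 * (5 * j.rem (w, θ) + w * fderiv ℝ j.rem (w, θ) (1, 0))

/-- `∂_θ f` for the function `f` given by the jet. -/
def dθ (j : Jet) (w θ : ℝ) : ℝ :=
  deriv j.c0 θ + w * deriv j.c1 θ + w ^ 2 * deriv j.c2 θ + w ^ 3 * deriv j.c3 θ +
    w ^ 4 * fderiv ℝ j.rem (w, θ) (0, 1)

theorem hasFDerivAt_fst_mul_val (j : Jet) (p : ℝ × ℝ) :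
    HasFDerivAt (fun p : ℝ × ℝ => p.1 * j.val p.1 p.2)
      (j.hat p.1 p.2 • ContinuousLinearMap.fst ℝ ℝ ℝ +
        (p.1 * j.dθ p.1 p.2) • ContinuousLinearMap.snd ℝ ℝ ℝ) p := by
  have hw : HasFDerivAt (fun p : ℝ × ℝ => p.1) (ContinuousLinearMap.fst ℝ ℝ ℝ) p := hasFDerivAt_fst
  have hc : ∀ {c : ℝ → ℝ}, ContDiff ℝ ∞ c → HasFDerivAt (fun p : ℝ × ℝ => c p.2)
      (deriv c p.2 • ContinuousLinearMap.snd ℝ ℝ ℝ) p := fun h =>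
    ((h.differentiable (by simp)) p.2).hasDerivAt.comp_hasFDerivAt p hasFDerivAt_snd
  have hr := ((j.smoothRem.differentiable (by simp)) p).hasFDerivAt
  have key := hw.mul (((((hc j.smooth0).add (hw.mul (hc j.smooth1))).add
    ((hw.pow 2).mul (hc j.smooth2))).add ((hw.pow 3).mul (hc j.smooth3))).add ((hw.pow 4).mul hr))
  refine (key.congr_fderiv ?_)
  ext
  · simp [hat]
    ring
  · simp [dθ]
    ring

theorem continuous_val (j : Jet) : Continuous fun p : ℝ × ℝ => j.val p.1 p.2 :=
  j.contDiff_val.continuous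

end Jet

/-- Jets of the four correction functions. -/
structure Jets where
  t : Jet
  r : Jet
  θ : Jet
  φ : Jet

def Jets.corrections (j : Jets) : Corrections := ⟨j.t.val, j.r.val, j.θ.val, j.φ.val⟩

/-- Chain rule with `dw = -w² dr'`; since a correction enters as `w * f`, its radial derivative is
`-w²` times `hat`. -/
theorem hasFDerivAt_inv_mul_val (j : Jet) {x : Fin 4 → ℝ} (hx : x 1 ≠ 0) :
    HasFDerivAt (fun x : Fin 4 → ℝ => (x 1)⁻¹ * j.val (x 1)⁻¹ (x 2))
      ((-(x 1)⁻¹ ^ 2 * j.hat (x 1)⁻¹ (x 2)) • ContinuousLinearMap.proj (R := ℝ) 1 +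
        ((x 1)⁻¹ * j.dθ (x 1)⁻¹ (x 2)) • ContinuousLinearMap.proj (R := ℝ) 2) x := by
  have h1 : HasFDerivAt (fun x : Fin 4 → ℝ => (x 1)⁻¹)
      (-((x 1) ^ 2)⁻¹ • ContinuousLinearMap.proj (R := ℝ) 1) x :=
    (hasDerivAt_inv hx).comp_hasFDerivAt x (hasFDerivAt_apply 1 x)
  have h2 := HasFDerivAt.comp (g := fun p : ℝ × ℝ => p.1 * j.val p.1 p.2) x
    (j.hasFDerivAt_fst_mul_val ((x 1)⁻¹, x 2)) (h1.prodMk (hasFDerivAt_apply 2 x))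
  refine h2.congr_fderiv ?_
  ext v
  simp
  ring

theorem hasFDerivAt_toBL {M : ℝ} (hM : 0 < M) (j : Jets) {x : Fin 4 → ℝ}
    (hx : 2 * M < x 1) :
    HasFDerivAt (toBL M j.corrections) (ContinuousLinearMap.pi
      (![ContinuousLinearMap.proj (R := ℝ) 0 + ((1 - 2 * M * (x 1)⁻¹)⁻¹ -
            (x 1)⁻¹ ^ 2 * j.t.hat (x 1)⁻¹ (x 2)) • ContinuousLinearMap.proj (R := ℝ) 1 +
          ((x 1)⁻¹ * j.t.dθ (x 1)⁻¹ (x 2)) • ContinuousLinearMap.proj (R := ℝ) 2,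
        (1 - (x 1)⁻¹ ^ 2 * j.r.hat (x 1)⁻¹ (x 2)) • ContinuousLinearMap.proj (R := ℝ) 1 +
          ((x 1)⁻¹ * j.r.dθ (x 1)⁻¹ (x 2)) • ContinuousLinearMap.proj (R := ℝ) 2,
        (-(x 1)⁻¹ ^ 2 * j.θ.hat (x 1)⁻¹ (x 2)) • ContinuousLinearMap.proj (R := ℝ) 1 +
          (1 + (x 1)⁻¹ * j.θ.dθ (x 1)⁻¹ (x 2)) • ContinuousLinearMap.proj (R := ℝ) 2,
        ContinuousLinearMap.proj (R := ℝ) 3 +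
          (-(x 1)⁻¹ ^ 2 * j.φ.hat (x 1)⁻¹ (x 2)) • ContinuousLinearMap.proj (R := ℝ) 1 +
          ((x 1)⁻¹ * j.φ.dθ (x 1)⁻¹ (x 2)) • ContinuousLinearMap.proj (R := ℝ) 2] :
        Fin 4 → (Fin 4 → ℝ) →L[ℝ] ℝ)) x := by
  have hx0 : x 1 ≠ 0 := by linarith
  have hp : ∀ i : Fin 4, HasFDerivAt (fun x : Fin 4 → ℝ => x i)
      (ContinuousLinearMap.proj (R := ℝ) i) x := fun i => hasFDerivAt_apply i x
  rw [hasFDerivAt_pi']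
  intro i
  fin_cases i
  · have hne : x 1 / (2 * M) - 1 ≠ 0 := by
      rw [sub_ne_zero, ne_eq, div_eq_one_iff_eq (by positivity)]
      exact hx.ne'
    have hl : HasDerivAt (fun r => 2 * M * Real.log (r / (2 * M) - 1))
        (2 * M * (1 / (2 * M) / (x 1 / (2 * M) - 1))) (x 1) :=
      ((((hasDerivAt_id (x 1)).div_const (2 * M)).sub_const 1).log hne).const_mul (2 * M)
    have h := (((hp 0).add (hp 1)).add (hl.comp_hasFDerivAt x (hp 1))).add
      (hasFDerivAt_inv_mul_val j.t hx0)
    refine h.congr_fderiv ?_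
    ext v
    have h1 : 1 - 2 * M * (x 1)⁻¹ ≠ 0 := by
      rw [sub_ne_zero, ne_eq, eq_comm, ← div_eq_mul_inv, div_eq_one_iff_eq hx0]
      exact hx.ne
    -- The derivative of `r' + 2M ln(r'/2M - 1)` is `1 + 2M / (r' - 2M) = (1 - 2M / r')⁻¹`.
    have h2 : (1 - 2 * M * (x 1)⁻¹)⁻¹ = 1 + 2 * M * (1 / (2 * M) / (x 1 / (2 * M) - 1)) := by
      have h3 : x 1 - 2 * M ≠ 0 := by linarith
      have h4 : x 1 / (2 * M) - 1 = (x 1 - 2 * M) / (2 * M) := by field_simp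
      have h5 : 1 - 2 * M * (x 1)⁻¹ = (x 1 - 2 * M) / x 1 := by field_simp
      rw [h4, h5]
      field_simp
      ring
    simp [h2]
    ring
  · refine ((hp 1).add (hasFDerivAt_inv_mul_val j.r hx0)).congr_fderiv ?_
    ext v
    simp
    ring
  · refine ((hp 2).add (hasFDerivAt_inv_mul_val j.θ hx0)).congr_fderiv ?_
    ext v
    simp
    ring
  · refine ((hp 3).add (hasFDerivAt_inv_mul_val j.φ hx0)).congr_fderiv ?_
    ext v
    simp
    ring

/-- The matrix `∂_μ F^α` of the change of coordinates `F = toBL M c`. -/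
theorem jacobian_toBL {M : ℝ} (hM : 0 < M) (j : Jets) {x : Fin 4 → ℝ}
    (hx : 2 * M < x 1) :
    (Matrix.of fun α μ => fderiv ℝ (toBL M j.corrections) x (Pi.single μ 1) α) =
      !![1, (1 - 2 * M * (x 1)⁻¹)⁻¹ - (x 1)⁻¹ ^ 2 * j.t.hat (x 1)⁻¹ (x 2),
          (x 1)⁻¹ * j.t.dθ (x 1)⁻¹ (x 2), 0;
        0, 1 - (x 1)⁻¹ ^ 2 * j.r.hat (x 1)⁻¹ (x 2), (x 1)⁻¹ * j.r.dθ (x 1)⁻¹ (x 2), 0;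
        0, -(x 1)⁻¹ ^ 2 * j.θ.hat (x 1)⁻¹ (x 2), 1 + (x 1)⁻¹ * j.θ.dθ (x 1)⁻¹ (x 2), 0;
        0, -(x 1)⁻¹ ^ 2 * j.φ.hat (x 1)⁻¹ (x 2), (x 1)⁻¹ * j.φ.dθ (x 1)⁻¹ (x 2), 1] := by
  rw [(hasFDerivAt_toBL hM j hx).fderiv]
  ext α μ
  fin_cases α <;> fin_cases μ <;> simp

/-! ### Expansions as identities in a commutative ring with `W ^ 4 = 0`. -/

/-- The algebra behind the first terms of the conditions on the change of coordinates. -/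
theorem leading_algebra {K : Type*} [CommRing K]
    {W M a S C E₁ E₂ T T₀ T' R X X₀ X' X'' P P₀ P' s c q sg Si Di L : K}
    (hW : W ^ 4 = 0) (hT : T = T₀ + W * T') (hX : X = X₀ + W * X') (hP : P = P₀ + W * P')
    (hs : s = S * (1 + (W * X'') ^ 2 * E₂) + C * (W * X'' + (W * X'') ^ 3 * E₁))
    (hq : q = 1 + W ^ 2 * R) (hsg : sg = q ^ 2 + a ^ 2 * c ^ 2 * W ^ 2)
    (hSi : sg * Si = 1) (hL : (1 - 2 * M * W) * L = 1)
    {A B Cw t₁ r₁ Tθ Rθ Xθ Pθ : K}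
    (hA : A = 1 - 2 * M * W * q * Si) (hB : B = 2 * M * a * W * q * s ^ 2 * Si)
    (hCw : Cw = s ^ 2 * (q ^ 2 + a ^ 2 * W ^ 2 + 2 * M * a ^ 2 * W ^ 3 * q * s ^ 2 * Si))
    (ht₁ : t₁ = L - W ^ 2 * T) :
    W ^ 3 * (A * t₁ * (W * Tθ) + B * (t₁ * (W * Pθ) - W * Tθ * (W ^ 2 * P)) -
      sg * Di * r₁ * (W * Rθ) + sg * X * (1 + W * Xθ) + Cw * P * (W * Pθ)) = W ^ 3 * X₀ ∧
    W * (A * t₁ - B * (W ^ 2 * P)) = W * (1 - W ^ 2 * T₀) ∧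
    W ^ 3 * (B * t₁ + Cw * P) = W ^ 3 * (S ^ 2 * P₀) := by
  have h1 : sg = 1 + W ^ 2 * (2 * R + W ^ 2 * R ^ 2 + a ^ 2 * c ^ 2) := by
    clear * - hq hsg; subst hq hsg; ring
  have h2 : W ^ 2 * Si = W ^ 2 := by
    clear * - hW hSi h1; subst h1; linear_combination W ^ 2 * hSi - (Si * (2 * R + W ^ 2 * R ^ 2 +
      a ^ 2 * c ^ 2)) * hW
  have h3 : W ^ 3 * s ^ 2 = W ^ 3 * S ^ 2 := by
    clear * - hW hs; subst hs; grind
  -- The geometric series stops: with `x = 2 * M * W`, `(1 - x) * (1 + x + x ^ 2 + x ^ 3) = 1 - x ^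
  -- 4 = 1`.
  have hL2 : L = 1 + 2 * M * W + 4 * M ^ 2 * W ^ 2 + 8 * M ^ 3 * W ^ 3 := by
    clear * - hW hL
    linear_combination (1 + 2 * M * W + 4 * M ^ 2 * W ^ 2 + 8 * M ^ 3 * W ^ 3) * hL +
      16 * M ^ 4 * L * hW
  have hA2 : W * A = W - 2 * M * W ^ 2 := by
    clear * - hW hA h2 hq; subst hA hq; grind
  have hB2 : B = W * (2 * M * a * q * s ^ 2 * Si) := by rw [hB]; ring
  have hCw2 : W ^ 3 * Cw = W ^ 3 * S ^ 2 := by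
    have : W ^ 3 * q = W ^ 3 := by clear * - hW hq; subst hq; grind
    clear * - hW hCw h3 this; grind
  have h5 : W ^ 3 * B = 0 := by
    clear * - hW hB2; subst hB2; grind
  have h6 : W ^ 3 * sg = W ^ 3 := by
    clear * - hW h1; subst h1; grind
  clear hs hsg hSi hL hA hCw h1 h2
  refine ⟨?_, ?_, ?_⟩
  · have e1 : W ^ 3 * (A * t₁ * (W * Tθ)) = 0 := by linear_combination A * t₁ * Tθ * hW
    have e2 : W ^ 3 * (B * (t₁ * (W * Pθ) - W * Tθ * (W ^ 2 * P))) = 0 := by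
      linear_combination (t₁ * (W * Pθ) - W * Tθ * (W ^ 2 * P)) * h5
    have e3 : W ^ 3 * (sg * Di * r₁ * (W * Rθ)) = 0 := by linear_combination sg * Di * r₁ * Rθ * hW
    have e4 : W ^ 3 * (Cw * P * (W * Pθ)) = 0 := by linear_combination Cw * P * Pθ * hW
    have e5 : W ^ 3 * (sg * X * (1 + W * Xθ)) = W ^ 3 * X₀ := by
      linear_combination X * (1 + W * Xθ) * h6 + W ^ 3 * (1 + W * Xθ) * hX +
        (X' * (1 + W * Xθ) + X₀ * Xθ) * hW
    linear_combination e1 + e2 - e3 + e4 + e5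
  · have e1 : W * (B * (W ^ 2 * P)) = 0 := by linear_combination P * h5
    have e2 : W * (A * t₁) = W * (1 - W ^ 2 * T₀) := by
      rw [← mul_assoc, hA2]; clear * - hW hL2 hT ht₁; subst ht₁ hL2 hT; grind
    linear_combination e2 - e1
  · linear_combination t₁ * h5 + P * hCw2 + W ^ 3 * S ^ 2 * hP + S ^ 2 * P' * hW

/-- Here the zeroth coefficients of the corrections of `t`, `θ`, `φ` are already zero, so `W * X` is
divisible by `W ^ 2` and the unknown remainders `E₁`, `E₂` of sine and cosine drop out. Components
with one angular index are needed only modulo `w ^ 3`, which is expressed by an extra factor `W` on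
both sides. -/
theorem expansion_algebra {K : Type*} [CommRing K]
    {W M a S C E₁ E₂ T' R R' X X' P' s c q sg Si dl Di L : K}
    {T₁ T₂ T₃ R₀ R₁ R₂ R₃ X₁ X₂ X₃ P₁ P₂ P₃ : K}
    {DT₁ DT₂ DT₃ DR₀ DR₁ DR₂ DR₃ DX₁ DX₂ DX₃ DP₁ DP₂ DP₃ : K}
    (hW : W ^ 4 = 0) (hSC : S ^ 2 + C ^ 2 = 1)
    (hT' : T' = 2 * W * T₁ + 3 * W ^ 2 * T₂ + 4 * W ^ 3 * T₃)
    (hR : R = R₀ + W * R₁ + W ^ 2 * R₂ + W ^ 3 * R₃)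
    (hR' : R' = R₀ + 2 * W * R₁ + 3 * W ^ 2 * R₂ + 4 * W ^ 3 * R₃)
    (hX : X = W * X₁ + W ^ 2 * X₂ + W ^ 3 * X₃)
    (hX' : X' = 2 * W * X₁ + 3 * W ^ 2 * X₂ + 4 * W ^ 3 * X₃)
    (hP' : P' = 2 * W * P₁ + 3 * W ^ 2 * P₂ + 4 * W ^ 3 * P₃)
    (hs : s = S * (1 + (W * X) ^ 2 * E₂) + C * (W * X + (W * X) ^ 3 * E₁))
    (hc : c = C * (1 + (W * X) ^ 2 * E₂) - S * (W * X + (W * X) ^ 3 * E₁))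
    (hq : q = 1 + W ^ 2 * R) (hsg : sg = q ^ 2 + a ^ 2 * c ^ 2 * W ^ 2)
    (hdl : dl = q ^ 2 - 2 * M * W * q + a ^ 2 * W ^ 2)
    (hSi : sg * Si = 1) (hDi : dl * Di = 1) (hL : (1 - 2 * M * W) * L = 1)
    {A B Cw t₁ r₁ Tθ Rθ Xθ Pθ : K}
    (hA : A = 1 - 2 * M * W * q * Si) (hB : B = 2 * M * a * W * q * s ^ 2 * Si)
    (hCw : Cw = s ^ 2 * (q ^ 2 + a ^ 2 * W ^ 2 + 2 * M * a ^ 2 * W ^ 3 * q * s ^ 2 * Si))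
    (ht₁ : t₁ = L - W ^ 2 * T') (hr₁ : r₁ = 1 - W ^ 2 * R')
    (hTθ : Tθ = W * DT₁ + W ^ 2 * DT₂ + W ^ 3 * DT₃)
    (hRθ : Rθ = DR₀ + W * DR₁ + W ^ 2 * DR₂ + W ^ 3 * DR₃)
    (hXθ : Xθ = W * DX₁ + W ^ 2 * DX₂ + W ^ 3 * DX₃)
    (hPθ : Pθ = W * DP₁ + W ^ 2 * DP₂ + W ^ 3 * DP₃) :
    A = 1 - 2 * M * W + 2 * M * (R₀ + a ^ 2 * C ^ 2) * W ^ 3 ∧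
    A * t₁ - B * (W ^ 2 * P') = 1 + (2 * M * (R₀ + a ^ 2 * C ^ 2) - 2 * T₁) * W ^ 3 ∧
    W * (A * (W * Tθ) + B * (W * Pθ)) = W * (W ^ 2 * DT₁) ∧
    W * B = W * (2 * M * a * S ^ 2 * W) ∧
    A * t₁ ^ 2 - 2 * B * t₁ * (W ^ 2 * P') - sg * Di * r₁ ^ 2 - sg * (W ^ 2 * X' ^ 2) -
      Cw * (W ^ 2 * P' ^ 2) = (2 * R₀ + a ^ 2 * S ^ 2) * W ^ 2 +
        (4 * R₁ + 8 * M * R₀ - 4 * T₁ + 4 * M * a ^ 2) * W ^ 3 ∧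
    W * (A * t₁ * (W * Tθ) + B * (t₁ * (W * Pθ) - W * Tθ * (W ^ 2 * P')) -
      sg * Di * r₁ * (W * Rθ) + sg * X' * (1 + W * Xθ) + Cw * P' * (W * Pθ)) =
      W * ((2 * X₁ - DR₀) * W + (DT₁ - DR₁ - 2 * M * DR₀ + 3 * X₂) * W ^ 2) ∧
    W * (B * t₁ + Cw * P') =
      W * (S ^ 2 * (2 * M * a + 2 * P₁) * W + S ^ 2 * (4 * M ^ 2 * a + 3 * P₂) * W ^ 2) ∧
    W ^ 2 * (A * (W * Tθ) ^ 2 + 2 * B * (W * Tθ) * (W * Pθ) - sg * Di * (W * Rθ) ^ 2) -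
      sg * (1 + W * Xθ) ^ 2 - Cw * (W * Pθ) ^ 2 =
      -(1 + (2 * R₀ + a ^ 2 * C ^ 2 + 2 * DX₁) * W ^ 2 + (2 * R₁ + 2 * DX₂) * W ^ 3) ∧
    W ^ 2 * (B * (W * Tθ)) - Cw * (W * Pθ) = -(S ^ 2 * (DP₁ * W ^ 2 + DP₂ * W ^ 3)) ∧
    Cw = S ^ 2 + (2 * S * C * X₁ + S ^ 2 * (2 * R₀ + a ^ 2)) * W ^ 2 +
      (2 * S * C * X₂ + S ^ 2 * (2 * R₁ + 2 * M * a ^ 2 * S ^ 2)) * W ^ 3 := by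
  have hs2 : s = S + C * (W ^ 2 * X₁ + W ^ 3 * X₂) := by
    clear * - hW hX hs; subst hs hX; grind
  have hs3 : s ^ 2 = S ^ 2 + 2 * S * C * (W ^ 2 * X₁ + W ^ 3 * X₂) := by
    clear * - hW hs2; subst hs2; grind
  have hc2 : c = C - S * (W ^ 2 * X₁ + W ^ 3 * X₂) := by
    clear * - hW hX hc; subst hc hX; grind
  have hq2 : q = 1 + W ^ 2 * R₀ + W ^ 3 * R₁ := by
    clear * - hW hq hR; subst hq hR; grind
  have hsg2 : sg = 1 + W ^ 2 * (2 * R₀ + a ^ 2 * C ^ 2) + 2 * W ^ 3 * R₁ := by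
    clear * - hW hsg hc2 hq2; subst hsg hc2 hq2; grind
  -- Inverses are unique, so it suffices that the proposed truncated series multiplies `sg` to 1.
  have hSi2 : Si = 1 - W ^ 2 * (2 * R₀ + a ^ 2 * C ^ 2) - 2 * W ^ 3 * R₁ := by
    have : sg * (1 - W ^ 2 * (2 * R₀ + a ^ 2 * C ^ 2) - 2 * W ^ 3 * R₁) = 1 := by
      clear * - hW hsg2; subst hsg2; grind
    linear_combination (1 - W ^ 2 * (2 * R₀ + a ^ 2 * C ^ 2) - 2 * W ^ 3 * R₁) * hSi - Si * this
  have hL2 : L = 1 + 2 * M * W + 4 * M ^ 2 * W ^ 2 + 8 * M ^ 3 * W ^ 3 := by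
    clear * - hW hL
    linear_combination (1 + 2 * M * W + 4 * M ^ 2 * W ^ 2 + 8 * M ^ 3 * W ^ 3) * hL +
      16 * M ^ 4 * L * hW
  have hA2 : A = 1 - 2 * M * W + 2 * M * (R₀ + a ^ 2 * C ^ 2) * W ^ 3 := by
    clear * - hW hA hq2 hSi2; subst hA hq2 hSi2; grind
  have hB2 : B = 2 * M * a * (W * S ^ 2 + W ^ 3 *
      (2 * S * C * X₁ - S ^ 2 * (R₀ + a ^ 2 * C ^ 2))) := by
    rw [hs3] at hB; clear * - hW hB hq2 hSi2; subst hB hq2 hSi2; grind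
  have hCw2 : Cw = S ^ 2 + (2 * S * C * X₁ + S ^ 2 * (2 * R₀ + a ^ 2)) * W ^ 2 +
      (2 * S * C * X₂ + S ^ 2 * (2 * R₁ + 2 * M * a ^ 2 * S ^ 2)) * W ^ 3 := by
    rw [hs3] at hCw; clear * - hW hCw hq2 hSi2; subst hCw hq2 hSi2; grind
  obtain ⟨Y, hYdef⟩ : ∃ Y, sg * Di = Y := ⟨_, rfl⟩
  -- `Y` is `Σ / Δ`. The series is checked by multiplying out against `dl` and then cancelling `dl`
  -- with its inverse `Di`.
  have hY : Y = 1 + 2 * M * W + (4 * M ^ 2 - a ^ 2 + a ^ 2 * C ^ 2) * W ^ 2 +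
      (8 * M ^ 3 - 4 * M * a ^ 2 + 2 * M * a ^ 2 * C ^ 2 - 2 * M * R₀) * W ^ 3 := by
    have : sg = (1 + 2 * M * W + (4 * M ^ 2 - a ^ 2 + a ^ 2 * C ^ 2) * W ^ 2 +
      (8 * M ^ 3 - 4 * M * a ^ 2 + 2 * M * a ^ 2 * C ^ 2 - 2 * M * R₀) * W ^ 3) * dl := by
      clear * - hW hsg2 hdl hq2; subst hsg2 hdl hq2; grind
    clear * - this hDi hYdef
    linear_combination -hYdef + Di * this + (1 + 2 * M * W +
      (4 * M ^ 2 - a ^ 2 + a ^ 2 * C ^ 2) * W ^ 2 +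
      (8 * M ^ 3 - 4 * M * a ^ 2 + 2 * M * a ^ 2 * C ^ 2 - 2 * M * R₀) * W ^ 3) * hDi
  have ht2 : t₁ = 1 + 2 * M * W + 4 * M ^ 2 * W ^ 2 + (8 * M ^ 3 - 2 * T₁) * W ^ 3 := by
    clear * - hW ht₁ hL2 hT'; subst ht₁ hL2 hT'; grind
  have hr2 : r₁ = 1 - W ^ 2 * R₀ - 2 * W ^ 3 * R₁ := by
    clear * - hW hr₁ hR'; subst hr₁ hR'; grind
  have hP2 : W ^ 2 * P' = 2 * W ^ 3 * P₁ := by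
    clear * - hW hP'; subst hP'; grind
  rw [hYdef]
  clear hSi hDi hA hB hCw hsg hdl hs3 hq2 hSi2 hL hL2 ht₁ hr₁ hYdef hR' hs hc hs2 hc2
  refine ⟨hA2, ?_, ?_, ?_, ?_, ?_, ?_, ?_, ?_, hCw2⟩
  · rw [hP2]; clear * - hW hA2 ht2 hB2; subst hA2 ht2 hB2; grind
  · clear * - hW hA2 hB2 hTθ hPθ; subst hA2 hB2 hTθ hPθ; grind
  · clear * - hW hB2; subst hB2; grind
  · have h1 : W ^ 2 * X' ^ 2 = 4 * W ^ 4 * X₁ ^ 2 := by clear * - hW hX'; subst hX'; grind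
    have h2 : W ^ 2 * P' ^ 2 = 0 := by clear * - hW hP'; subst hP'; grind
    have h3 : B * t₁ * (W ^ 2 * P') = 0 := by rw [hP2]; clear * - hW hB2; subst hB2; grind
    have h4 : A * t₁ ^ 2 = 1 + 2 * M * W + 4 * M ^ 2 * W ^ 2 +
        (8 * M ^ 3 - 4 * T₁ + 2 * M * (R₀ + a ^ 2 * C ^ 2)) * W ^ 3 := by
      clear * - hW hA2 ht2; subst hA2 ht2; grind
    have h5 : Y * r₁ ^ 2 = 1 + 2 * M * W + (4 * M ^ 2 - a ^ 2 + a ^ 2 * C ^ 2 - 2 * R₀) * W ^ 2 +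
        (8 * M ^ 3 - 4 * M * a ^ 2 + 2 * M * a ^ 2 * C ^ 2 - 2 * M * R₀ -
          4 * M * R₀ - 4 * R₁) * W ^ 3 := by
      clear * - hW hY hr2; subst hY hr2; grind
    -- The series of `A * t₁ ^ 2` and `Y * r₁ ^ 2` share the terms `1 + 2 * M * W + 4 * M ^ 2 * W ^
    -- 2 + 8 * M ^ 3 * W ^ 3`: the logarithm in `t` removes the pure Schwarzschild part. At order `W
    -- ^ 2`, `a ^ 2 * (1 - C ^ 2)` becomes `a ^ 2 * S ^ 2`.
    clear * - hW h1 h2 h3 h4 h5 hSC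
    linear_combination h4 - h5 - sg * h1 - Cw * h2 - 2 * h3 - (a ^ 2 * W ^ 2) * hSC -
      4 * sg * X₁ ^ 2 * hW
  · have h1 : W * (A * t₁ * (W * Tθ)) = W ^ 3 * DT₁ := by
      clear * - hW hA2 ht2 hTθ; subst hA2 ht2 hTθ; grind
    have h2 : W * (B * (t₁ * (W * Pθ) - W * Tθ * (W ^ 2 * P'))) = 0 := by
      rw [hP2]; clear * - hW hB2 hPθ; subst hB2 hPθ; grind
    have h3 : W * (Y * r₁ * (W * Rθ)) =
        W * (DR₀ * W + (DR₁ + 2 * M * DR₀) * W ^ 2) := by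
      clear * - hW hY hr2 hRθ; subst hY hr2 hRθ; grind
    have h4 : W * (sg * X' * (1 + W * Xθ)) = W * (2 * X₁ * W + 3 * X₂ * W ^ 2) := by
      clear * - hW hsg2 hX' hXθ; subst hsg2 hX' hXθ; grind
    have h5 : W * (Cw * P' * (W * Pθ)) = 0 := by
      clear * - hW hP' hPθ; subst hP' hPθ; grind
    clear * - h1 h2 h3 h4 h5
    linear_combination h1 + h2 - h3 + h4 + h5
  · clear * - hW hB2 ht2 hCw2 hP'; subst hB2 ht2 hCw2 hP'; grind
  · have h1 : W ^ 2 * (A * (W * Tθ) ^ 2 + 2 * B * (W * Tθ) * (W * Pθ) - Y * (W * Rθ) ^ 2) = 0 := by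
      clear * - hW
      linear_combination (A * Tθ ^ 2 + 2 * B * Tθ * Pθ - Y * Rθ ^ 2) * hW
    have h2 : Cw * (W * Pθ) ^ 2 = 0 := by
      clear * - hW hPθ; subst hPθ; grind
    have h3 : sg * (1 + W * Xθ) ^ 2 =
        1 + (2 * R₀ + a ^ 2 * C ^ 2 + 2 * DX₁) * W ^ 2 + (2 * R₁ + 2 * DX₂) * W ^ 3 := by
      clear * - hW hsg2 hXθ; subst hsg2 hXθ; grind
    clear * - h1 h2 h3
    linear_combination h1 - h2 - h3
  · have h1 : W ^ 2 * (B * (W * Tθ)) = 0 := by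
      clear * - hW hB2; subst hB2; grind
    have h2 : Cw * (W * Pθ) = S ^ 2 * (DP₁ * W ^ 2 + DP₂ * W ^ 3) := by
      clear * - hW hCw2 hPθ; subst hCw2 hPθ; grind
    clear * - h1 h2
    linear_combination h1 - h2

/-! ### The components of the Kerr metric as functions of `(w, θ)`, with `w = 1 / r'` -/

namespace Jets

variable (M a : ℝ) (j : Jets) (p : ℝ × ℝ)

/-- The Boyer-Lindquist polar angle. -/
def pol : ℝ := p.2 + p.1 * j.θ.val p.1 p.2

/-- The Boyer-Lindquist radius times `w`. -/
def q : ℝ := 1 + p.1 ^ 2 * j.r.val p.1 p.2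

/-- `w² Σ`. -/
def sg : ℝ := j.q p ^ 2 + a ^ 2 * Real.cos (j.pol p) ^ 2 * p.1 ^ 2

/-- `w² Δ`. -/
def dl : ℝ := j.q p ^ 2 - 2 * M * p.1 * j.q p + a ^ 2 * p.1 ^ 2

/-- The component `tt` of the Kerr metric. -/
def gA : ℝ := 1 - 2 * M * p.1 * j.q p * (j.sg a p)⁻¹

/-- The component `tφ` of the Kerr metric. -/
def gB : ℝ := 2 * M * a * p.1 * j.q p * Real.sin (j.pol p) ^ 2 * (j.sg a p)⁻¹

/-- The component `φφ` of the Kerr metric, times `-w²`. -/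
def gC : ℝ := Real.sin (j.pol p) ^ 2 * (j.q p ^ 2 + a ^ 2 * p.1 ^ 2 +
  2 * M * a ^ 2 * p.1 ^ 3 * j.q p * Real.sin (j.pol p) ^ 2 * (j.sg a p)⁻¹)

/-- `∂t / ∂r'`. -/
def t₁ : ℝ := (1 - 2 * M * p.1)⁻¹ - p.1 ^ 2 * j.t.hat p.1 p.2

/-- `∂r / ∂r'`. -/
def r₁ : ℝ := 1 - p.1 ^ 2 * j.r.hat p.1 p.2

def g01 : ℝ := j.gA M a p * j.t₁ M p - j.gB M a p * (p.1 ^ 2 * j.φ.hat p.1 p.2)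

def g02 : ℝ := j.gA M a p * (p.1 * j.t.dθ p.1 p.2) + j.gB M a p * (p.1 * j.φ.dθ p.1 p.2)

def g11 : ℝ := j.gA M a p * j.t₁ M p ^ 2 -
  2 * j.gB M a p * j.t₁ M p * (p.1 ^ 2 * j.φ.hat p.1 p.2) -
  j.sg a p * (j.dl M a p)⁻¹ * j.r₁ p ^ 2 - j.sg a p * (p.1 ^ 2 * j.θ.hat p.1 p.2 ^ 2) -
  j.gC M a p * (p.1 ^ 2 * j.φ.hat p.1 p.2 ^ 2)

def g12 : ℝ := j.gA M a p * j.t₁ M p * (p.1 * j.t.dθ p.1 p.2) +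
  j.gB M a p * (j.t₁ M p * (p.1 * j.φ.dθ p.1 p.2) -
    p.1 * j.t.dθ p.1 p.2 * (p.1 ^ 2 * j.φ.hat p.1 p.2)) -
  j.sg a p * (j.dl M a p)⁻¹ * j.r₁ p * (p.1 * j.r.dθ p.1 p.2) +
  j.sg a p * j.θ.hat p.1 p.2 * (1 + p.1 * j.θ.dθ p.1 p.2) +
  j.gC M a p * j.φ.hat p.1 p.2 * (p.1 * j.φ.dθ p.1 p.2)

def g13 : ℝ := j.gB M a p * j.t₁ M p + j.gC M a p * j.φ.hat p.1 p.2

/-- The component `θθ` times `w²`. -/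
def g22 : ℝ := p.1 ^ 2 * (j.gA M a p * (p.1 * j.t.dθ p.1 p.2) ^ 2 +
    2 * j.gB M a p * (p.1 * j.t.dθ p.1 p.2) * (p.1 * j.φ.dθ p.1 p.2) -
    j.sg a p * (j.dl M a p)⁻¹ * (p.1 * j.r.dθ p.1 p.2) ^ 2) -
  j.sg a p * (1 + p.1 * j.θ.dθ p.1 p.2) ^ 2 - j.gC M a p * (p.1 * j.φ.dθ p.1 p.2) ^ 2

/-- The component `θφ` times `w²`. -/
def g23 : ℝ := p.1 ^ 2 * (j.gB M a p * (p.1 * j.t.dθ p.1 p.2)) -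
  j.gC M a p * (p.1 * j.φ.dθ p.1 p.2)

/-- The components of the Kerr metric, those with two angular indices multiplied by `w²`. -/
def scaled : Matrix (Fin 4) (Fin 4) ℝ :=
  !![j.gA M a p, j.g01 M a p, j.g02 M a p, j.gB M a p;
     j.g01 M a p, j.g11 M a p, j.g12 M a p, j.g13 M a p;
     j.g02 M a p, j.g12 M a p, j.g22 M a p, j.g23 M a p;
     j.gB M a p, j.g13 M a p, j.g23 M a p, -j.gC M a p]

end Jets

/-- The powers of `w` in `Jets.scaled`. -/
def scaling : Matrix (Fin 4) (Fin 4) ℕ :=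
  !![0, 0, 0, 0; 0, 0, 0, 0; 0, 0, 2, 2; 0, 0, 2, 2]

/-- Homogeneity: `r = w⁻¹ q`, `Σ = w⁻² sg` and `Δ = w⁻² dl`, so in each entry the powers of `w` can
be collected. -/
theorem kerrMetric_toBL (M a : ℝ) (j : Jets) {x : Fin 4 → ℝ} (hx : 0 < x 1) :
    kerrMetric M a (toBL M j.corrections x) =
      let p := ((x 1)⁻¹, x 2)
      !![j.gA M a p, 0, 0, j.gB M a p;
         0, -(j.sg a p * (j.dl M a p)⁻¹), 0, 0;
         0, 0, -(x 1 ^ 2 * j.sg a p), 0;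
         j.gB M a p, 0, 0, -(x 1 ^ 2 * j.gC M a p)] := by
  obtain ⟨w, hw, hxw⟩ : ∃ w : ℝ, 0 < w ∧ x 1 = w⁻¹ := ⟨(x 1)⁻¹, inv_pos.2 hx, by simp⟩
  have hw0 := hw.ne'
  have hr : toBL M j.corrections x 1 = w⁻¹ * j.q (w, x 2) := by
    simp [toBL, Jets.corrections, Jets.q, hxw]
    field_simp
  have hθ : toBL M j.corrections x 2 = j.pol (w, x 2) := by
    simp [toBL, Jets.corrections, Jets.pol, hxw]
  have hS : (w⁻¹ * j.q (w, x 2)) ^ 2 + a ^ 2 * Real.cos (j.pol (w, x 2)) ^ 2 =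
      (w ^ 2)⁻¹ * j.sg a (w, x 2) := by
    simp only [Jets.sg]
    field_simp
  have hD : (w⁻¹ * j.q (w, x 2)) ^ 2 - 2 * M * (w⁻¹ * j.q (w, x 2)) + a ^ 2 =
      (w ^ 2)⁻¹ * j.dl M a (w, x 2) := by
    simp only [Jets.dl]
    field_simp
  simp only [kerrMetric, hr, hθ, hS, hD, hxw, inv_inv]
  have e : ∀ c : ℝ, c * (w⁻¹ * j.q (w, x 2)) / ((w ^ 2)⁻¹ * j.sg a (w, x 2)) =
      c * w * j.q (w, x 2) * (j.sg a (w, x 2))⁻¹ := fun c => by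
    rw [div_eq_mul_inv, mul_inv, inv_inv]
    field_simp
  have e' : ∀ c d : ℝ, c * (w⁻¹ * j.q (w, x 2)) * d / ((w ^ 2)⁻¹ * j.sg a (w, x 2)) =
      c * w * j.q (w, x 2) * d * (j.sg a (w, x 2))⁻¹ := fun c d => by
    rw [mul_div_right_comm, e]
    ring
  have e'' : (w ^ 2)⁻¹ * j.sg a (w, x 2) / ((w ^ 2)⁻¹ * j.dl M a (w, x 2)) =
      j.sg a (w, x 2) * (j.dl M a (w, x 2))⁻¹ := by
    rw [mul_div_mul_left _ _ (by positivity), div_eq_mul_inv]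
  congr 1
  ext μ ν
  fin_cases μ <;> fin_cases ν <;> simp [Jets.gA, Jets.gB, Jets.gC, e, e', e'']
  -- The identity is polynomial in the inverse of `sg`, so nothing about the vanishing of `sg` is
  -- needed.
  generalize (j.sg a (w, x 2))⁻¹ = i
  field_simp

theorem scaling_mul_kerrIn {M : ℝ} (hM : 0 < M) (a : ℝ) (j : Jets) {x : Fin 4 → ℝ}
    (hx : 2 * M < x 1) (μ ν : Fin 4) :
    (x 1)⁻¹ ^ scaling μ ν * kerrIn M a j.corrections x μ ν = j.scaled M a ((x 1)⁻¹, x 2) μ ν := by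
  have hx0 : 0 < x 1 := by linarith
  have hx0' := hx0.ne'
  rw [kerrIn, pullback, jacobian_toBL hM j hx, kerrMetric_toBL M a j hx0]
  fin_cases μ <;> fin_cases ν <;>
    simp [scaling, Jets.scaled, Matrix.mul_apply, Fin.sum_univ_four, Jets.g01, Jets.g02, Jets.g11,
      Jets.g12, Jets.g13, Jets.g22, Jets.g23, Jets.t₁, Jets.r₁]
  all_goals
    generalize (1 - 2 * M * (x 1)⁻¹)⁻¹ = L
    generalize (j.dl M a ((x 1)⁻¹, x 2))⁻¹ = Di
    field_simp
    try ring

/-! ### Classes of the metric components in `ScriRing`. -/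

/-- The classes of the Taylor coefficients of a jet and of their derivatives. -/
structure JetRep (j : Jet) (w : ScriRing) where
  k0 : ScriRing
  k1 : ScriRing
  k2 : ScriRing
  k3 : ScriRing
  d0 : ScriRing
  d1 : ScriRing
  d2 : ScriRing
  d3 : ScriRing
  rep0 : Rep (fun p => j.c0 p.2) k0
  rep1 : Rep (fun p => j.c1 p.2) k1
  rep2 : Rep (fun p => j.c2 p.2) k2
  rep3 : Rep (fun p => j.c3 p.2) k3
  repD0 : Rep (fun p => deriv j.c0 p.2) d0
  repD1 : Rep (fun p => deriv j.c1 p.2) d1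
  repD2 : Rep (fun p => deriv j.c2 p.2) d2
  repD3 : Rep (fun p => deriv j.c3 p.2) d3
  repVal : Rep (fun p => j.val p.1 p.2) (k0 + w * k1 + w ^ 2 * k2 + w ^ 3 * k3)
  repHat : Rep (fun p => j.hat p.1 p.2) (k0 + 2 * w * k1 + 3 * w ^ 2 * k2 + 4 * w ^ 3 * k3)
  repDθ : Rep (fun p => j.dθ p.1 p.2) (d0 + w * d1 + w ^ 2 * d2 + w ^ 3 * d3)

theorem Rep.cast {f : ℝ × ℝ → ℝ} {k l : ScriRing} (hf : Rep f k) (h : k = l) : Rep f l := h ▸ hf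

theorem Rep.exists_comp_snd {f : ℝ → ℝ} (hf : Continuous f) : ∃ k, Rep (fun p => f p.2) k :=
  Rep.exists_of_continuous (hf.comp continuous_snd)

/-- Coefficients and their derivatives are continuous, hence bounded near scri, and the remainder
drops out by its factor `w ^ 4`. Differentiation in `θ` is not an operation on `ScriRing`, so the
classes of the derivatives are separate data. -/
theorem JetRep.nonempty (j : Jet) {w : ScriRing} (hw : Rep Prod.fst w) :
    Nonempty (JetRep j w) := by
  have hd : ∀ {c : ℝ → ℝ}, ContDiff ℝ ∞ c → Continuous (deriv c) :=
    fun h => h.continuous_deriv (by simp)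
  obtain ⟨k0, h0⟩ := Rep.exists_comp_snd j.smooth0.continuous
  obtain ⟨k1, h1⟩ := Rep.exists_comp_snd j.smooth1.continuous
  obtain ⟨k2, h2⟩ := Rep.exists_comp_snd j.smooth2.continuous
  obtain ⟨k3, h3⟩ := Rep.exists_comp_snd j.smooth3.continuous
  obtain ⟨d0, e0⟩ := Rep.exists_comp_snd (hd j.smooth0)
  obtain ⟨d1, e1⟩ := Rep.exists_comp_snd (hd j.smooth1)
  obtain ⟨d2, e2⟩ := Rep.exists_comp_snd (hd j.smooth2)
  obtain ⟨d3, e3⟩ := Rep.exists_comp_snd (hd j.smooth3)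
  have hR := j.smoothRem.continuous
  have hR' : ∀ v, Continuous fun p : ℝ × ℝ => fderiv ℝ j.rem (p.1, p.2) v := fun v =>
    (j.smoothRem.continuous_fderiv (by simp)).clm_apply continuous_const
  obtain ⟨r, hr⟩ := Rep.exists_of_continuous
    (show Continuous fun p : ℝ × ℝ => j.rem (p.1, p.2) from hR)
  obtain ⟨r1, hr1⟩ := Rep.exists_of_continuous (hR' (1, 0))
  obtain ⟨r2, hr2⟩ := Rep.exists_of_continuous (hR' (0, 1))
  have h4 := hw.pow_fst
  refine ⟨⟨k0, k1, k2, k3, d0, d1, d2, d3, h0, h1, h2, h3, e0, e1, e2, e3, ?_, ?_, ?_⟩⟩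
  · refine (((((h0.add (hw.mul h1)).add ((hw.pow 2).mul h2)).add ((hw.pow 3).mul h3))).add
      ((hw.pow 4).mul hr)).cast ?_
    rw [h4]; ring
  · refine ((((h0.add (((Rep.ofNat 2).mul hw).mul h1)).add
      (((Rep.ofNat 3).mul (hw.pow 2)).mul h2)).add (((Rep.ofNat 4).mul (hw.pow 3)).mul h3)).add
      ((hw.pow 4).mul (((Rep.ofNat 5).mul hr).add (hw.mul hr1)))).cast ?_
    rw [h4]; ring
  · refine (((((e0.add (hw.mul e1)).add ((hw.pow 2).mul e2)).add ((hw.pow 3).mul e3))).add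
      ((hw.pow 4).mul hr2)).cast ?_
    rw [h4]; ring

/-- For `u = w * f` the quotients `(sin u - u) / u ^ 3` and `(cos u - 1) / u ^ 2` are bounded near
scri, with value 0 at `u = 0` by the convention for division. Only the boundedness of `E₁` and `E₂`
matters. -/
theorem exists_rep_sin_cos {f : ℝ × ℝ → ℝ} {w k : ScriRing} (hw : Rep Prod.fst w) (hf : Rep f k) :
    ∃ E₁ E₂, Rep (fun p => Real.sin (p.1 * f p)) (w * k + (w * k) ^ 3 * E₁) ∧
      Rep (fun p => Real.cos (p.1 * f p)) (1 + (w * k) ^ 2 * E₂) := by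
  have hfst : Tendsto (fun p : ℝ × ℝ => p.1) nearScri (𝓝 0) :=
    tendsto_fst.mono_right nhdsWithin_le_nhds
  have h0 : Tendsto (fun p : ℝ × ℝ => p.1 * f p) nearScri (𝓝 0) := by
    have := (isBigO_refl (fun p : ℝ × ℝ => p.1) nearScri).mul hf.bdd
    simp only [mul_one] at this
    exact this.trans_tendsto hfst
  have hle : ∀ᶠ p in nearScri, |p.1 * f p| ≤ 1 := by
    filter_upwards [h0.eventually (Metric.closedBall_mem_nhds 0 one_pos)] with p hp
    simpa [Real.dist_eq] using hp
  obtain ⟨E₁, h1⟩ := Rep.exists_of_isBigO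
    (f := fun p => (Real.sin (p.1 * f p) - p.1 * f p) / (p.1 * f p) ^ 3) (by
      refine IsBigO.of_bound 1 (hle.mono fun p hp => ?_)
      have h2 := Real.sin_bound hp
      set u := p.1 * f p
      have h3 : |Real.sin u - u| ≤ |u| ^ 3 := by
        have h4 : |u| ^ 5 ≤ |u| ^ 3 := pow_le_pow_of_le_one (abs_nonneg u) hp (by norm_num)
        have h5 : |Real.sin u - u| ≤ |Real.sin u - (u - u ^ 3 / 6)| + |u ^ 3 / 6| := by
          refine le_trans (le_of_eq ?_) (abs_sub (Real.sin u - (u - u ^ 3 / 6)) (u ^ 3 / 6))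
          congr 1; ring
        have h6 : |u ^ 3 / 6| = |u| ^ 3 / 6 := by rw [abs_div, abs_pow]; norm_num
        have h7 : 0 ≤ |u| ^ 3 := by positivity
        linarith
      rw [norm_div, Real.norm_eq_abs, Real.norm_eq_abs, abs_pow, norm_one, mul_one]
      exact div_le_one_of_le₀ h3 (by positivity))
  obtain ⟨E₂, h2⟩ := Rep.exists_of_isBigO
    (f := fun p => (Real.cos (p.1 * f p) - 1) / (p.1 * f p) ^ 2) (by
      refine IsBigO.of_bound 1 (.of_forall fun p => ?_)
      set u := p.1 * f p
      have h3 : |Real.cos u - 1| ≤ |u| ^ 2 := by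
        rw [sq_abs, abs_le]
        have := Real.one_sub_sq_div_two_le_cos (x := u)
        have := Real.cos_le_one u
        constructor <;> nlinarith [sq_nonneg u]
      rw [norm_div, Real.norm_eq_abs, Real.norm_eq_abs, abs_pow, norm_one, mul_one]
      exact div_le_one_of_le₀ h3 (by positivity))
  have hu := hw.mul hf
  refine ⟨E₁, E₂, (hu.add ((hu.pow 3).mul h1)).congr (.of_forall fun p => ?_),
    (Rep.one.add ((hu.pow 2).mul h2)).congr (.of_forall fun p => ?_)⟩
  · rcases eq_or_ne (p.1 * f p) 0 with h | h
    · simp [h]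
    · simp only
      rw [mul_div_cancel₀ _ (pow_ne_zero 3 h)]
      ring
  · rcases eq_or_ne (p.1 * f p) 0 with h | h
    · simp [h]
    · simp only
      rw [mul_div_cancel₀ _ (pow_ne_zero 2 h)]
      ring

/-- The classes of the ingredients of the Kerr metric in the coordinates given by `j`. -/
structure ChartRep (M a : ℝ) (j : Jets) where
  W : ScriRing
  M' : ScriRing
  a' : ScriRing
  S : ScriRing
  C : ScriRing
  repW : Rep Prod.fst W
  repM : Rep (fun _ => M) M'
  repa : Rep (fun _ => a) a'
  repS : Rep (fun p => Real.sin p.2) S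
  repC : Rep (fun p => Real.cos p.2) C
  t : JetRep j.t W
  r : JetRep j.r W
  θ : JetRep j.θ W
  φ : JetRep j.φ W
  X : ScriRing
  s : ScriRing
  c : ScriRing
  q : ScriRing
  sg : ScriRing
  dl : ScriRing
  E₁ : ScriRing
  E₂ : ScriRing
  L : ScriRing
  Si : ScriRing
  Di : ScriRing
  X_eq : X = θ.k0 + W * θ.k1 + W ^ 2 * θ.k2 + W ^ 3 * θ.k3
  s_eq : s = S * (1 + (W * X) ^ 2 * E₂) + C * (W * X + (W * X) ^ 3 * E₁)
  c_eq : c = C * (1 + (W * X) ^ 2 * E₂) - S * (W * X + (W * X) ^ 3 * E₁)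
  q_eq : q = 1 + W ^ 2 * (r.k0 + W * r.k1 + W ^ 2 * r.k2 + W ^ 3 * r.k3)
  sg_eq : sg = q ^ 2 + a' ^ 2 * c ^ 2 * W ^ 2
  dl_eq : dl = q ^ 2 - 2 * M' * W * q + a' ^ 2 * W ^ 2
  repSin : Rep (fun p => Real.sin (j.pol p)) s
  repq : Rep (fun p => j.q p) q
  repsg : Rep (fun p => j.sg a p) sg
  repL : Rep (fun p => (1 - 2 * M * p.1)⁻¹) L
  repSi : Rep (fun p => (j.sg a p)⁻¹) Si
  repDi : Rep (fun p => (j.dl M a p)⁻¹) Di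
  L_eq : (1 - 2 * M' * W) * L = 1
  Si_eq : sg * Si = 1
  Di_eq : dl * Di = 1

/-- The addition theorems expand sine and cosine of the perturbed polar angle. The functions `1 - 2
* M * w`, `sg` and `dl` are continuous and equal 1 on scri, so they are invertible there. -/
theorem ChartRep.nonempty (M a : ℝ) (j : Jets) : Nonempty (ChartRep M a j) := by
  obtain ⟨W, hW⟩ := Rep.exists_of_continuous continuous_fst
  obtain ⟨M', hM⟩ := Rep.exists_of_continuous (f := fun _ => M) continuous_const
  obtain ⟨a', ha⟩ := Rep.exists_of_continuous (f := fun _ => a) continuous_const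
  obtain ⟨S, hS⟩ := Rep.exists_comp_snd Real.continuous_sin
  obtain ⟨C, hC⟩ := Rep.exists_comp_snd Real.continuous_cos
  obtain ⟨t⟩ := JetRep.nonempty j.t hW
  obtain ⟨r⟩ := JetRep.nonempty j.r hW
  obtain ⟨θ⟩ := JetRep.nonempty j.θ hW
  obtain ⟨φ⟩ := JetRep.nonempty j.φ hW
  obtain ⟨E₁, E₂, h1, h2⟩ := exists_rep_sin_cos hW θ.repVal
  have hsin := ((hS.mul h2).add (hC.mul h1)).congr (g := fun p => Real.sin (j.pol p))
    (.of_forall fun p => by simp only [Jets.pol, Real.sin_add])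
  have hcos := ((hC.mul h2).sub (hS.mul h1)).congr (g := fun p => Real.cos (j.pol p))
    (.of_forall fun p => by simp only [Jets.pol, Real.cos_add])
  have hq : Rep (fun p => j.q p) _ := Rep.one.add ((hW.pow 2).mul r.repVal)
  have hsg : Rep (fun p => j.sg a p) _ :=
    (hq.pow 2).add (((ha.pow 2).mul (hcos.pow 2)).mul (hW.pow 2))
  have hdl : Rep (fun p => j.dl M a p) _ := ((hq.pow 2).sub
    ((((Rep.ofNat 2).mul hM).mul hW).mul hq)).add ((ha.pow 2).mul (hW.pow 2))
  have hl : Rep (fun p => 1 - 2 * M * p.1) _ := Rep.one.sub (((Rep.ofNat 2).mul hM).mul hW)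
  have cr : Continuous fun p : ℝ × ℝ => j.q p :=
    continuous_const.add ((continuous_fst.pow 2).mul j.r.continuous_val)
  have cp : Continuous fun p : ℝ × ℝ => j.pol p :=
    continuous_snd.add (continuous_fst.mul j.θ.continuous_val)
  obtain ⟨-, L, hL, eL⟩ := hl.exists_inv (by fun_prop) (by simp)
  obtain ⟨-, Si, hSi, eSi⟩ := hsg.exists_inv (by unfold Jets.sg; fun_prop)
    (by simp [Jets.sg, Jets.q])
  obtain ⟨-, Di, hDi, eDi⟩ := hdl.exists_inv (by unfold Jets.dl; fun_prop)
    (by simp [Jets.dl, Jets.q])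
  exact ⟨⟨W, M', a', S, C, hW, hM, ha, hS, hC, t, r, θ, φ, _, _, _, _, _, _, E₁, E₂, L, Si, Di,
    rfl, rfl, rfl, rfl, rfl, rfl, hsin, hq, hsg, hL, hSi, hDi, eL, eSi, eDi⟩⟩

/-- An equality that holds only after multiplication by `w ^ m` loses `m` of the four orders. -/
theorem Rep.isBigO_sub {f g : ℝ × ℝ → ℝ} {w k l : ScriRing} (hw : Rep Prod.fst w) (m n : ℕ)
    (hmn : m + n = 4) (hf : Rep f k) (hg : Rep g l) (h : w ^ m * k = w ^ m * l) :
    (fun p => f p - g p) =O[nearScri] fun p => p.1 ^ n := by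
  have h1 := (((hw.pow m).mul hf).eq_iff ((hw.pow m).mul hg)).1 h
  refine isBigO_of_fst_pow_mul (m := m) ?_
  rw [hmn]
  exact h1.congr_left fun p => by ring

namespace Jets

variable {M a : ℝ} {j : Jets} {W A B Cw t₁ r₁ sg Di T R X P X' P' : ScriRing}

theorem rep01 (hW : Rep Prod.fst W) (hA : Rep (fun p => j.gA M a p) A)
    (hB : Rep (fun p => j.gB M a p) B) (ht₁ : Rep (fun p => j.t₁ M p) t₁)
    (hP' : Rep (fun p => j.φ.hat p.1 p.2) P') :
    Rep (fun p => j.g01 M a p) (A * t₁ - B * (W ^ 2 * P')) :=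
  (hA.mul ht₁).sub (hB.mul ((hW.pow 2).mul hP'))

theorem rep02 (hW : Rep Prod.fst W) (hA : Rep (fun p => j.gA M a p) A)
    (hB : Rep (fun p => j.gB M a p) B) (hT : Rep (fun p => j.t.dθ p.1 p.2) T)
    (hP : Rep (fun p => j.φ.dθ p.1 p.2) P) :
    Rep (fun p => j.g02 M a p) (A * (W * T) + B * (W * P)) :=
  (hA.mul (hW.mul hT)).add (hB.mul (hW.mul hP))

theorem rep11 (hW : Rep Prod.fst W) (hA : Rep (fun p => j.gA M a p) A)
    (hB : Rep (fun p => j.gB M a p) B) (hC : Rep (fun p => j.gC M a p) Cw)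
    (hsg : Rep (fun p => j.sg a p) sg) (hDi : Rep (fun p => (j.dl M a p)⁻¹) Di)
    (ht₁ : Rep (fun p => j.t₁ M p) t₁) (hr₁ : Rep (fun p => j.r₁ p) r₁)
    (hX' : Rep (fun p => j.θ.hat p.1 p.2) X') (hP' : Rep (fun p => j.φ.hat p.1 p.2) P') :
    Rep (fun p => j.g11 M a p) (A * t₁ ^ 2 - 2 * B * t₁ * (W ^ 2 * P') - sg * Di * r₁ ^ 2 -
      sg * (W ^ 2 * X' ^ 2) - Cw * (W ^ 2 * P' ^ 2)) :=
  ((((hA.mul (ht₁.pow 2)).sub ((((Rep.ofNat 2).mul hB).mul ht₁).mul ((hW.pow 2).mul hP'))).sub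
    ((hsg.mul hDi).mul (hr₁.pow 2))).sub (hsg.mul ((hW.pow 2).mul (hX'.pow 2)))).sub
    (hC.mul ((hW.pow 2).mul (hP'.pow 2)))

theorem rep12 (hW : Rep Prod.fst W) (hA : Rep (fun p => j.gA M a p) A)
    (hB : Rep (fun p => j.gB M a p) B) (hC : Rep (fun p => j.gC M a p) Cw)
    (hsg : Rep (fun p => j.sg a p) sg) (hDi : Rep (fun p => (j.dl M a p)⁻¹) Di)
    (ht₁ : Rep (fun p => j.t₁ M p) t₁) (hr₁ : Rep (fun p => j.r₁ p) r₁)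
    (hX' : Rep (fun p => j.θ.hat p.1 p.2) X') (hP' : Rep (fun p => j.φ.hat p.1 p.2) P')
    (hT : Rep (fun p => j.t.dθ p.1 p.2) T) (hR : Rep (fun p => j.r.dθ p.1 p.2) R)
    (hX : Rep (fun p => j.θ.dθ p.1 p.2) X) (hP : Rep (fun p => j.φ.dθ p.1 p.2) P) :
    Rep (fun p => j.g12 M a p) (A * t₁ * (W * T) + B * (t₁ * (W * P) - W * T * (W ^ 2 * P')) -
      sg * Di * r₁ * (W * R) + sg * X' * (1 + W * X) + Cw * P' * (W * P)) :=
  (((((hA.mul ht₁).mul (hW.mul hT)).add (hB.mul ((ht₁.mul (hW.mul hP)).sub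
    ((hW.mul hT).mul ((hW.pow 2).mul hP'))))).sub (((hsg.mul hDi).mul hr₁).mul (hW.mul hR))).add
    ((hsg.mul hX').mul (Rep.one.add (hW.mul hX)))).add ((hC.mul hP').mul (hW.mul hP))

theorem rep13 (hB : Rep (fun p => j.gB M a p) B) (hC : Rep (fun p => j.gC M a p) Cw)
    (ht₁ : Rep (fun p => j.t₁ M p) t₁) (hP' : Rep (fun p => j.φ.hat p.1 p.2) P') :
    Rep (fun p => j.g13 M a p) (B * t₁ + Cw * P') :=
  (hB.mul ht₁).add (hC.mul hP')

theorem rep22 (hW : Rep Prod.fst W) (hA : Rep (fun p => j.gA M a p) A)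
    (hB : Rep (fun p => j.gB M a p) B) (hC : Rep (fun p => j.gC M a p) Cw)
    (hsg : Rep (fun p => j.sg a p) sg) (hDi : Rep (fun p => (j.dl M a p)⁻¹) Di)
    (hT : Rep (fun p => j.t.dθ p.1 p.2) T) (hR : Rep (fun p => j.r.dθ p.1 p.2) R)
    (hX : Rep (fun p => j.θ.dθ p.1 p.2) X) (hP : Rep (fun p => j.φ.dθ p.1 p.2) P) :
    Rep (fun p => j.g22 M a p) (W ^ 2 * (A * (W * T) ^ 2 + 2 * B * (W * T) * (W * P) -
      sg * Di * (W * R) ^ 2) - sg * (1 + W * X) ^ 2 - Cw * (W * P) ^ 2) :=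
  (((hW.pow 2).mul (((hA.mul ((hW.mul hT).pow 2)).add
    ((((Rep.ofNat 2).mul hB).mul (hW.mul hT)).mul (hW.mul hP))).sub
      ((hsg.mul hDi).mul ((hW.mul hR).pow 2)))).sub
    (hsg.mul ((Rep.one.add (hW.mul hX)).pow 2))).sub (hC.mul ((hW.mul hP).pow 2))

theorem rep23 (hW : Rep Prod.fst W) (hB : Rep (fun p => j.gB M a p) B)
    (hC : Rep (fun p => j.gC M a p) Cw) (hT : Rep (fun p => j.t.dθ p.1 p.2) T)
    (hP : Rep (fun p => j.φ.dθ p.1 p.2) P) :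
    Rep (fun p => j.g23 M a p) (W ^ 2 * (B * (W * T)) - Cw * (W * P)) :=
  ((hW.pow 2).mul (hB.mul (hW.mul hT))).sub (hC.mul (hW.mul hP))

end Jets

namespace ChartRep

variable {M a : ℝ} {j : Jets} (D : ChartRep M a j)

theorem repA : Rep (fun p => j.gA M a p) (1 - 2 * D.M' * D.W * D.q * D.Si) :=
  Rep.one.sub (((((Rep.ofNat 2).mul D.repM).mul D.repW).mul D.repq).mul D.repSi)

theorem repB : Rep (fun p => j.gB M a p)
    (2 * D.M' * D.a' * D.W * D.q * D.s ^ 2 * D.Si) :=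
  ((((((Rep.ofNat 2).mul D.repM).mul D.repa).mul D.repW).mul D.repq).mul (D.repSin.pow 2)).mul
    D.repSi

theorem repCw : Rep (fun p => j.gC M a p) (D.s ^ 2 * (D.q ^ 2 + D.a' ^ 2 * D.W ^ 2 +
    2 * D.M' * D.a' ^ 2 * D.W ^ 3 * D.q * D.s ^ 2 * D.Si)) :=
  (D.repSin.pow 2).mul (((D.repq.pow 2).add ((D.repa.pow 2).mul (D.repW.pow 2))).add
    (((((((Rep.ofNat 2).mul D.repM).mul (D.repa.pow 2)).mul (D.repW.pow 3)).mul D.repq).mul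
      (D.repSin.pow 2)).mul D.repSi))

theorem rept₁ : Rep (fun p => j.t₁ M p) (D.L - D.W ^ 2 *
    (D.t.k0 + 2 * D.W * D.t.k1 + 3 * D.W ^ 2 * D.t.k2 + 4 * D.W ^ 3 * D.t.k3)) :=
  D.repL.sub ((D.repW.pow 2).mul D.t.repHat)

theorem repr₁ : Rep (fun p => j.r₁ p) (1 - D.W ^ 2 *
    (D.r.k0 + 2 * D.W * D.r.k1 + 3 * D.W ^ 2 * D.r.k2 + 4 * D.W ^ 3 * D.r.k3)) :=
  Rep.one.sub ((D.repW.pow 2).mul D.r.repHat)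

end ChartRep

/-! ### Expansions of the metric components. -/

/-- The leading terms of the conditions on the change of coordinates. -/
theorem leading_expansion (M a : ℝ) (j : Jets) :
    (fun p => j.g12 M a p - j.θ.c0 p.2) =O[nearScri] (fun p => p.1 ^ 1) ∧
    (fun p => j.g01 M a p - (1 - p.1 ^ 2 * j.t.c0 p.2)) =O[nearScri] (fun p => p.1 ^ 3) ∧
    (fun p => j.g13 M a p - Real.sin p.2 ^ 2 * j.φ.c0 p.2) =O[nearScri] (fun p => p.1 ^ 1) := by
  obtain ⟨D⟩ := ChartRep.nonempty M a j
  obtain ⟨h12, h01, h13⟩ := leading_algebra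
    (T := D.t.k0 + 2 * D.W * D.t.k1 + 3 * D.W ^ 2 * D.t.k2 + 4 * D.W ^ 3 * D.t.k3)
    (X := D.θ.k0 + 2 * D.W * D.θ.k1 + 3 * D.W ^ 2 * D.θ.k2 + 4 * D.W ^ 3 * D.θ.k3)
    (P := D.φ.k0 + 2 * D.W * D.φ.k1 + 3 * D.W ^ 2 * D.φ.k2 + 4 * D.W ^ 3 * D.φ.k3)
    (T' := 2 * D.t.k1 + 3 * D.W * D.t.k2 + 4 * D.W ^ 2 * D.t.k3)
    (X' := 2 * D.θ.k1 + 3 * D.W * D.θ.k2 + 4 * D.W ^ 2 * D.θ.k3)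
    (P' := 2 * D.φ.k1 + 3 * D.W * D.φ.k2 + 4 * D.W ^ 2 * D.φ.k3)
    D.repW.pow_fst (by ring) (by ring) (by ring) D.s_eq D.q_eq D.sg_eq D.Si_eq (Di := D.Di)
    (r₁ := (1 - D.W ^ 2 *
      (D.r.k0 + 2 * D.W * D.r.k1 + 3 * D.W ^ 2 * D.r.k2 + 4 * D.W ^ 3 * D.r.k3)))
    D.L_eq rfl rfl rfl rfl
  refine ⟨Rep.isBigO_sub D.repW 3 1 rfl (Jets.rep12 D.repW D.repA D.repB D.repCw D.repsg D.repDi D.rept₁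
      D.repr₁ D.θ.repHat D.φ.repHat D.t.repDθ D.r.repDθ D.θ.repDθ D.φ.repDθ)
      D.θ.rep0 (h12 ..),
    Rep.isBigO_sub D.repW 1 3 rfl (Jets.rep01 D.repW D.repA D.repB D.rept₁ D.φ.repHat)
      (Rep.one.sub ((D.repW.pow 2).mul D.t.rep0)) ?_,
    Rep.isBigO_sub D.repW 3 1 rfl (Jets.rep13 D.repB D.repCw D.rept₁ D.φ.repHat)
      ((D.repS.pow 2).mul D.φ.rep0) h13⟩
  rw [pow_one]
  exact h01

/-- The orders are those demanded by `scaling` and `beyondQuadrupole`: `w ^ 4` for components with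
no or two angular indices, the latter carrying the factor `w ^ 2`, and `w ^ 3` for the mixed ones.
-/
theorem expansion (M a : ℝ) (j : Jets) (ht : ∀ θ ∈ Ioo 0 Real.pi, j.t.c0 θ = 0)
    (hθ : ∀ θ ∈ Ioo 0 Real.pi, j.θ.c0 θ = 0) (hφ : ∀ θ ∈ Ioo 0 Real.pi, j.φ.c0 θ = 0) :
    (fun p => j.gA M a p - (1 - 2 * M * p.1 +
      2 * M * (j.r.c0 p.2 + a ^ 2 * Real.cos p.2 ^ 2) * p.1 ^ 3)) =O[nearScri]
        (fun p => p.1 ^ 4) ∧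
    (fun p => j.g01 M a p - (1 + (2 * M * (j.r.c0 p.2 + a ^ 2 * Real.cos p.2 ^ 2) -
      2 * j.t.c1 p.2) * p.1 ^ 3)) =O[nearScri] (fun p => p.1 ^ 4) ∧
    (fun p => j.g02 M a p - p.1 ^ 2 * deriv j.t.c1 p.2) =O[nearScri] (fun p => p.1 ^ 3) ∧
    (fun p => j.gB M a p - 2 * M * a * Real.sin p.2 ^ 2 * p.1) =O[nearScri] (fun p => p.1 ^ 3) ∧
    (fun p => j.g11 M a p - ((2 * j.r.c0 p.2 + a ^ 2 * Real.sin p.2 ^ 2) * p.1 ^ 2 +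
      (4 * j.r.c1 p.2 + 8 * M * j.r.c0 p.2 - 4 * j.t.c1 p.2 + 4 * M * a ^ 2) * p.1 ^ 3))
        =O[nearScri] (fun p => p.1 ^ 4) ∧
    (fun p => j.g12 M a p - ((2 * j.θ.c1 p.2 - deriv j.r.c0 p.2) * p.1 +
      (deriv j.t.c1 p.2 - deriv j.r.c1 p.2 - 2 * M * deriv j.r.c0 p.2 + 3 * j.θ.c2 p.2) *
        p.1 ^ 2)) =O[nearScri] (fun p => p.1 ^ 3) ∧
    (fun p => j.g13 M a p - (Real.sin p.2 ^ 2 * (2 * M * a + 2 * j.φ.c1 p.2) * p.1 +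
      Real.sin p.2 ^ 2 * (4 * M ^ 2 * a + 3 * j.φ.c2 p.2) * p.1 ^ 2))
        =O[nearScri] (fun p => p.1 ^ 3) ∧
    (fun p => j.g22 M a p - -(1 + (2 * j.r.c0 p.2 + a ^ 2 * Real.cos p.2 ^ 2 +
      2 * deriv j.θ.c1 p.2) * p.1 ^ 2 + (2 * j.r.c1 p.2 + 2 * deriv j.θ.c2 p.2) * p.1 ^ 3))
        =O[nearScri] (fun p => p.1 ^ 4) ∧
    (fun p => j.g23 M a p - -(Real.sin p.2 ^ 2 * (deriv j.φ.c1 p.2 * p.1 ^ 2 +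
      deriv j.φ.c2 p.2 * p.1 ^ 3))) =O[nearScri] (fun p => p.1 ^ 4) ∧
    (fun p => j.gC M a p - (Real.sin p.2 ^ 2 + (2 * Real.sin p.2 * Real.cos p.2 * j.θ.c1 p.2 +
      Real.sin p.2 ^ 2 * (2 * j.r.c0 p.2 + a ^ 2)) * p.1 ^ 2 +
      (2 * Real.sin p.2 * Real.cos p.2 * j.θ.c2 p.2 + Real.sin p.2 ^ 2 * (2 * j.r.c1 p.2 +
        2 * M * a ^ 2 * Real.sin p.2 ^ 2)) * p.1 ^ 3)) =O[nearScri] (fun p => p.1 ^ 4) := by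
  obtain ⟨D⟩ := ChartRep.nonempty M a j
  -- Vanishing on the open interval is enough: `nearScri` sees only `0 < θ < π`, and openness passes
  -- the vanishing on to the derivative.
  have hev : ∀ {f : ℝ → ℝ} {k : ScriRing}, (∀ θ ∈ Ioo 0 Real.pi, f θ = 0) →
      Rep (fun p => f p.2) k → k = 0 := fun h hk =>
    hk.eq_of_eventuallyEq Rep.zero ((eventually_nearScri one_pos).mono fun p hp => h _ hp.2.2)
  have hder : ∀ {f : ℝ → ℝ}, (∀ θ ∈ Ioo 0 Real.pi, f θ = 0) →
      ∀ θ ∈ Ioo 0 Real.pi, deriv f θ = 0 := fun {f} h θ hθ => by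
    have : f =ᶠ[𝓝 θ] fun _ => 0 := by
      filter_upwards [isOpen_Ioo.mem_nhds hθ] with z hz using h z hz
    rw [this.deriv_eq, deriv_const]
  have t0 : D.t.k0 = 0 := hev ht D.t.rep0
  have t0' : D.t.d0 = 0 := hev (hder ht) D.t.repD0
  have θ0 : D.θ.k0 = 0 := hev hθ D.θ.rep0
  have θ0' : D.θ.d0 = 0 := hev (hder hθ) D.θ.repD0
  have φ0 : D.φ.k0 = 0 := hev hφ D.φ.rep0
  have φ0' : D.φ.d0 = 0 := hev (hder hφ) D.φ.repD0
  have hSC : D.S ^ 2 + D.C ^ 2 = 1 :=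
    ((D.repS.pow 2).add (D.repC.pow 2)).eq_of_eventuallyEq Rep.one
      (.of_forall fun p => Real.sin_sq_add_cos_sq p.2)
  obtain ⟨e00, e01, e02, e03, e11, e12, e13, e22, e23, e33⟩ := expansion_algebra
    (T' := D.t.k0 + 2 * D.W * D.t.k1 + 3 * D.W ^ 2 * D.t.k2 + 4 * D.W ^ 3 * D.t.k3)
    (X' := D.θ.k0 + 2 * D.W * D.θ.k1 + 3 * D.W ^ 2 * D.θ.k2 + 4 * D.W ^ 3 * D.θ.k3)
    (P' := D.φ.k0 + 2 * D.W * D.φ.k1 + 3 * D.W ^ 2 * D.φ.k2 + 4 * D.W ^ 3 * D.φ.k3)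
    (Tθ := D.t.d0 + D.W * D.t.d1 + D.W ^ 2 * D.t.d2 + D.W ^ 3 * D.t.d3)
    (Xθ := D.θ.d0 + D.W * D.θ.d1 + D.W ^ 2 * D.θ.d2 + D.W ^ 3 * D.θ.d3)
    (Pθ := D.φ.d0 + D.W * D.φ.d1 + D.W ^ 2 * D.φ.d2 + D.W ^ 3 * D.φ.d3)
    D.repW.pow_fst hSC (by rw [t0, zero_add]) rfl rfl (by rw [D.X_eq, θ0, zero_add])
    (by rw [θ0, zero_add]) (by rw [φ0, zero_add]) D.s_eq D.c_eq D.q_eq D.sg_eq D.dl_eq D.Si_eq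
    D.Di_eq D.L_eq rfl rfl rfl rfl rfl (by rw [t0', zero_add]) rfl (by rw [θ0', zero_add])
    (by rw [φ0', zero_add])
  have r2 : Rep (fun _ : ℝ × ℝ => (2 : ℝ)) 2 := Rep.ofNat 2
  have r3 : Rep (fun _ : ℝ × ℝ => (3 : ℝ)) 3 := Rep.ofNat 3
  have r4 : Rep (fun _ : ℝ × ℝ => (4 : ℝ)) 4 := Rep.ofNat 4
  have r8 : Rep (fun _ : ℝ × ℝ => (8 : ℝ)) 8 := Rep.ofNat 8
  have w1 := D.repW
  have w2 := D.repW.pow 2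
  have w3 := D.repW.pow 3
  have m := D.repM
  have m2 := r2.mul D.repM
  have a2 := D.repa.pow 2
  have s2 := D.repS.pow 2
  have sc := (r2.mul D.repS).mul D.repC
  have rc := D.r.rep0.add (a2.mul (D.repC.pow 2))
  have four : ∀ {f g : ℝ × ℝ → ℝ} {k l : ScriRing}, Rep f k → Rep g l → k = l →
      (fun p => f p - g p) =O[nearScri] (fun p => p.1 ^ 4) := fun hf hg h => (hf.eq_iff hg).1 h
  have three : ∀ {f g : ℝ × ℝ → ℝ} {k l : ScriRing}, Rep f k → Rep g l → D.W * k = D.W * l →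
      (fun p => f p - g p) =O[nearScri] (fun p => p.1 ^ 3) := fun hf hg h =>
    Rep.isBigO_sub w1 1 3 rfl hf hg (by rw [pow_one]; exact h)
  refine ⟨four D.repA ((Rep.one.sub (m2.mul w1)).add ((m2.mul rc).mul w3)) e00,
    four (Jets.rep01 D.repW D.repA D.repB D.rept₁ D.φ.repHat)
      (Rep.one.add (((m2.mul rc).sub (r2.mul D.t.rep1)).mul w3)) e01,
    three (Jets.rep02 D.repW D.repA D.repB D.t.repDθ D.φ.repDθ)
      (w2.mul D.t.repD1) e02,
    three D.repB (((m2.mul D.repa).mul s2).mul w1) e03,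
    four (Jets.rep11 D.repW D.repA D.repB D.repCw D.repsg D.repDi D.rept₁
      D.repr₁ D.θ.repHat D.φ.repHat)
      ((((r2.mul D.r.rep0).add (a2.mul s2)).mul w2).add
      (((((r4.mul D.r.rep1).add ((r8.mul m).mul D.r.rep0)).sub (r4.mul D.t.rep1)).add
        ((r4.mul m).mul a2)).mul w3)) e11,
    three (Jets.rep12 D.repW D.repA D.repB D.repCw D.repsg D.repDi D.rept₁
      D.repr₁ D.θ.repHat D.φ.repHat D.t.repDθ D.r.repDθ D.θ.repDθ D.φ.repDθ)
      ((((r2.mul D.θ.rep1).sub D.r.repD0).mul w1).add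
      ((((D.t.repD1.sub D.r.repD1).sub (m2.mul D.r.repD0)).add (r3.mul D.θ.rep2)).mul w2)) e12,
    three (Jets.rep13 D.repB D.repCw D.rept₁ D.φ.repHat)
      (((s2.mul ((m2.mul D.repa).add (r2.mul D.φ.rep1))).mul w1).add
      ((s2.mul (((r4.mul (m.pow 2)).mul D.repa).add (r3.mul D.φ.rep2))).mul w2)) e13,
    four (Jets.rep22 D.repW D.repA D.repB D.repCw D.repsg D.repDi D.t.repDθ
      D.r.repDθ D.θ.repDθ D.φ.repDθ)
      ((Rep.one.add ((((r2.mul D.r.rep0).add (a2.mul (D.repC.pow 2))).add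
      (r2.mul D.θ.repD1)).mul w2)).add (((r2.mul D.r.rep1).add (r2.mul D.θ.repD2)).mul w3)).neg e22,
    four (Jets.rep23 D.repW D.repB D.repCw D.t.repDθ D.φ.repDθ)
      (s2.mul ((D.φ.repD1.mul w2).add (D.φ.repD2.mul w3))).neg e23,
    four D.repCw ((s2.add (((sc.mul D.θ.rep1).add
      (s2.mul ((r2.mul D.r.rep0).add a2))).mul w2)).add
      (((sc.mul D.θ.rep2).add (s2.mul ((r2.mul D.r.rep1).add ((m2.mul a2).mul s2)))).mul w3)) e33⟩

/-! ### From arbitrary corrections to jets. -/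

/-- The corrections `c` are given by the jets `j` near scri. -/
def Jets.Represents (j : Jets) (c : Corrections) : Prop :=
  ∃ δ > 0, ∀ w θ : ℝ, |w| ≤ δ → c.t w θ = j.t.val w θ ∧ c.r w θ = j.r.val w θ ∧
    c.θ w θ = j.θ.val w θ ∧ c.φ w θ = j.φ.val w θ

theorem Corrections.SmoothAtScri.exists_jets {c : Corrections} (hc : c.SmoothAtScri) :
    ∃ j : Jets, j.Represents c := by
  obtain ⟨ε, hε, h⟩ := hc
  obtain ⟨jt, ht⟩ := exists_jet hε (h c.t (by simp))
  obtain ⟨jr, hr⟩ := exists_jet hε (h c.r (by simp))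
  obtain ⟨jθ, hθ⟩ := exists_jet hε (h c.θ (by simp))
  obtain ⟨jφ, hφ⟩ := exists_jet hε (h c.φ (by simp))
  exact ⟨⟨jt, jr, jθ, jφ⟩, ε / 2, by positivity, fun w θ hw =>
    ⟨ht w θ hw, hr w θ hw, hθ w θ hw, hφ w θ hw⟩⟩

theorem Jets.represents_self (j : Jets) : j.Represents j.corrections :=
  ⟨1, one_pos, fun _ _ _ => ⟨rfl, rfl, rfl, rfl⟩⟩

theorem Jets.smoothAtScri (j : Jets) : j.corrections.SmoothAtScri :=
  ⟨1, one_pos, by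
    simp only [List.forall_mem_cons, List.not_mem_nil, false_imp_iff, implies_true, and_true]
    exact ⟨j.t.contDiff_val.contDiffOn, j.r.contDiff_val.contDiffOn, j.θ.contDiff_val.contDiffOn,
      j.φ.contDiff_val.contDiffOn⟩⟩

/-- The pullback at a point depends only on the germ of the map. The two maps agree on the open set
`r' > δ⁻¹`, and `2 * δ⁻¹` lies strictly inside it. -/
theorem Jets.Represents.exists_kerrIn_eq {j : Jets} {c : Corrections} (h : j.Represents c)
    (M a : ℝ) : ∃ R₀ : ℝ, ∀ x : Fin 4 → ℝ, R₀ ≤ x 1 → 0 < x 1 →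
      kerrIn M a c x = kerrIn M a j.corrections x := by
  obtain ⟨δ, hδ, h⟩ := h
  refine ⟨2 * δ⁻¹, fun x hx hx0 => ?_⟩
  have hδ' : 0 < δ⁻¹ := inv_pos.2 hδ
  have hev : toBL M c =ᶠ[𝓝 x] toBL M j.corrections := by
    have : ∀ᶠ y : Fin 4 → ℝ in 𝓝 x, δ⁻¹ < y 1 :=
      (continuous_apply 1).continuousAt.eventually (lt_mem_nhds (by linarith))
    filter_upwards [this] with y hy
    have hy0 : 0 < y 1 := hδ'.trans hy
    obtain ⟨h1, h2, h3, h4⟩ := h (y 1)⁻¹ (y 2) (by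
      rw [abs_of_pos (inv_pos.2 hy0)]
      exact (inv_le_comm₀ hy0 hδ).2 hy.le)
    simp only [toBL, h1, h2, h3, h4, Jets.corrections]
  simp only [kerrIn, pullback, hev.fderiv_eq, hev.self_of_nhds]

theorem isO_kerrIn_sub_iff {M : ℝ} (hM : 0 < M) (a : ℝ) {j : Jets} {c : Corrections}
    (hj : j.Represents c) (n : ℕ) (μ ν : Fin 4) {h : (Fin 4 → ℝ) → ℝ} {H : ℝ × ℝ → ℝ}
    (hH : ∀ x : Fin 4 → ℝ, 0 < x 1 → x 2 ∈ Ioo 0 Real.pi →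
      (x 1)⁻¹ ^ scaling μ ν * h x = H ((x 1)⁻¹, x 2)) :
    IsO n (fun x => kerrIn M a c x μ ν - h x) ↔
      (fun p => j.scaled M a p μ ν - H p) =O[nearScri] fun p => p.1 ^ (scaling μ ν + n) := by
  obtain ⟨R₀, hR⟩ := hj.exists_kerrIn_eq M a
  -- The bound `2 * M + 1` keeps `r' > 2M`, where the Jacobian formula holds.
  rw [isO_iff_isBigO (R₀ := max R₀ (2 * M + 1))
    (F := fun p => (p.1 ^ scaling μ ν)⁻¹ * (j.scaled M a p μ ν - H p))]
  · have hpos : ∀ᶠ p in nearScri, p.1 ^ scaling μ ν ≠ 0 :=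
      (eventually_nearScri one_pos).mono fun p hp => pow_ne_zero _ hp.1.ne'
    constructor
    · intro h1
      refine (isBigO_fst_pow_mul (isBigO_refl _ _) h1).congr' ?_ EventuallyEq.rfl
      filter_upwards [hpos] with p hp using mul_inv_cancel_left₀ hp _
    · intro h1
      refine isBigO_of_fst_pow_mul (m := scaling μ ν) (h1.congr' ?_ EventuallyEq.rfl)
      filter_upwards [hpos] with p hp using (mul_inv_cancel_left₀ hp _).symm
  · intro x hx hx0 hθ
    have hx' : 2 * M < x 1 := by linarith [(le_max_right R₀ (2 * M + 1)).trans hx]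
    rw [hR x ((le_max_left _ _).trans hx) hx0, ← scaling_mul_kerrIn hM a j hx', ← hH x hx0 hθ,
      ← mul_sub, inv_mul_cancel_left₀]
    positivity

/-- The approximate Bondi-Sachs conditions, in terms of the jets. -/
theorem isApproxBondiSachsForm_iff {M : ℝ} (hM : 0 < M) (a : ℝ) {j : Jets} {c : Corrections}
    (hj : j.Represents c) : IsApproxBondiSachsForm (kerrIn M a c) ↔
      (fun p => j.g01 M a p - 1) =O[nearScri] (fun p => p.1 ^ 4) ∧
      (fun p => j.g11 M a p) =O[nearScri] (fun p => p.1 ^ 4) ∧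
      (fun p => j.g12 M a p) =O[nearScri] (fun p => p.1 ^ 3) ∧
      (fun p => j.g13 M a p) =O[nearScri] (fun p => p.1 ^ 3) := by
  have key : ∀ ν : Fin 4, IsO (beyondQuadrupole 1 ν)
      (fun x => kerrIn M a c x 1 ν - if ν = 0 then 1 else 0) ↔
      (fun p => j.scaled M a p 1 ν - if ν = 0 then 1 else 0) =O[nearScri]
        fun p => p.1 ^ (scaling 1 ν + beyondQuadrupole 1 ν) := fun ν =>
    isO_kerrIn_sub_iff hM a hj _ 1 ν fun x _ _ => by fin_cases ν <;> simp [scaling]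
  rw [IsApproxBondiSachsForm]
  simp only [key, Fin.forall_fin_succ]
  simp [scaling, beyondQuadrupole, Jets.scaled]

/-! ### Solving the Bondi-Sachs conditions. -/

/-- The Taylor coefficients of approximate Bondi-Sachs coordinates. -/
def Jets.IsBondiSachs (M a : ℝ) (j : Jets) : Prop :=
  ∀ θ ∈ Ioo 0 Real.pi, (j.t.c0 θ = 0 ∧ j.θ.c0 θ = 0 ∧ j.φ.c0 θ = 0) ∧
    j.r.c0 θ = -(a ^ 2 / 2) * Real.sin θ ^ 2 ∧
    j.t.c1 θ = M * a ^ 2 / 2 * (3 * Real.cos θ ^ 2 - 1) ∧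
    j.θ.c1 θ = -(a ^ 2 / 2) * (Real.sin θ * Real.cos θ) ∧
    j.r.c1 θ = -(M * a ^ 2 / 2) * Real.sin θ ^ 2 ∧
    j.θ.c2 θ = 0 ∧ j.φ.c1 θ = -(M * a) ∧ j.φ.c2 θ = -(4 / 3 * M ^ 2 * a)

theorem deriv_eq_on_Ioo {f g g' : ℝ → ℝ} (h : ∀ θ ∈ Ioo 0 Real.pi, f θ = g θ)
    (hg : ∀ θ, HasDerivAt g (g' θ) θ) : ∀ θ ∈ Ioo 0 Real.pi, deriv f θ = g' θ := fun θ hθ => by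
  have : f =ᶠ[𝓝 θ] g := by
    filter_upwards [isOpen_Ioo.mem_nhds hθ] with z hz using h z hz
  rw [this.deriv_eq, (hg θ).deriv]

theorem hasDerivAt_mul_sin_sq (k θ : ℝ) :
    HasDerivAt (fun θ => k * Real.sin θ ^ 2) (2 * k * (Real.sin θ * Real.cos θ)) θ :=
  (((Real.hasDerivAt_sin θ).pow 2).const_mul k).congr_deriv (by simp; ring)

theorem hasDerivAt_mul_sin_mul_cos (k θ : ℝ) :
    HasDerivAt (fun θ => k * (Real.sin θ * Real.cos θ))
      (k * (Real.cos θ ^ 2 - Real.sin θ ^ 2)) θ :=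
  (((Real.hasDerivAt_sin θ).mul (Real.hasDerivAt_cos θ)).const_mul k).congr_deriv (by ring)

theorem hasDerivAt_mul_three_cos_sq_sub_one (k θ : ℝ) :
    HasDerivAt (fun θ => k * (3 * Real.cos θ ^ 2 - 1)) (-(6 * k) * (Real.sin θ * Real.cos θ)) θ :=
  (((((Real.hasDerivAt_cos θ).pow 2).const_mul 3).sub_const 1).const_mul k).congr_deriv
    (by simp; ring)

/-- Once `τ₀`, `χ₀`, `ψ₀` vanish, the system is triangular: `g_11` at `w²` gives `ρ₀`, `g_01` at
`w³` gives `τ₁`, `g_11` at `w³` gives `ρ₁`. Differentiating these in `θ`, `g_12` at `w` and `w²`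
gives `χ₁` and `χ₂`; `g_13`, divided by `sin²θ`, gives `ψ₁` and `ψ₂`. -/
theorem isBondiSachs_of_isApproxBondiSachsForm {M : ℝ} (hM : 0 < M) (a : ℝ) {j : Jets}
    {c : Corrections} (hj : j.Represents c) (h : IsApproxBondiSachsForm (kerrIn M a c)) :
    j.IsBondiSachs M a := by
  obtain ⟨f01, f11, f12, f13⟩ := (isApproxBondiSachsForm_iff hM a hj).1 h
  obtain ⟨l12, l01, l13⟩ := leading_expansion M a j
  have s0 : ∀ θ ∈ Ioo 0 Real.pi, Real.sin θ ^ 2 ≠ 0 := fun θ hθ =>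
    pow_ne_zero 2 (Real.sin_pos_of_mem_Ioo hθ).ne'
  have θ0 : ∀ θ ∈ Ioo 0 Real.pi, j.θ.c0 θ = 0 := fun θ hθ =>
    (coeff_eq_zero (α0 := j.θ.c0) (α1 := 0) (α2 := 0) (α3 := 0)
      (((isBigO_fst_pow_of_le (by norm_num) f12).sub l12).congr_left
        fun p => by simp) hθ).1 le_rfl
  have t0 : ∀ θ ∈ Ioo 0 Real.pi, j.t.c0 θ = 0 := fun θ hθ =>
    (coeff_eq_zero (α0 := 0) (α1 := 0) (α2 := j.t.c0) (α3 := 0)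
      ((l01.sub (isBigO_fst_pow_of_le (by norm_num) f01)).congr_left
        fun p => by simp; ring) hθ).2.2.1 le_rfl
  have φ0 : ∀ θ ∈ Ioo 0 Real.pi, j.φ.c0 θ = 0 := fun θ hθ => by
    have := (coeff_eq_zero (α0 := fun θ => Real.sin θ ^ 2 * j.φ.c0 θ) (α1 := 0) (α2 := 0) (α3 := 0)
      (((isBigO_fst_pow_of_le (by norm_num) f13).sub l13).congr_left
        fun p => by simp) hθ).1 le_rfl
    exact (mul_eq_zero.1 this).resolve_left (s0 θ hθ)
  obtain ⟨-, e01, -, -, e11, e12, e13, -⟩ := expansion M a j t0 θ0 φ0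
  have c01 := fun θ hθ => coeff_eq_zero (n := 4) (θ := θ) (α0 := 0) (α1 := 0) (α2 := 0)
    (α3 := fun θ => 2 * M * (j.r.c0 θ + a ^ 2 * Real.cos θ ^ 2) - 2 * j.t.c1 θ)
    ((f01.sub e01).congr_left fun p => by simp; ring) hθ
  have c11 := fun θ hθ => coeff_eq_zero (n := 4) (θ := θ) (α0 := 0) (α1 := 0)
    (α2 := fun θ => 2 * j.r.c0 θ + a ^ 2 * Real.sin θ ^ 2)
    (α3 := fun θ => 4 * j.r.c1 θ + 8 * M * j.r.c0 θ - 4 * j.t.c1 θ + 4 * M * a ^ 2)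
    ((f11.sub e11).congr_left fun p => by simp; ring) hθ
  have c12 := fun θ hθ => coeff_eq_zero (n := 3) (θ := θ) (α0 := 0)
    (α1 := fun θ => 2 * j.θ.c1 θ - deriv j.r.c0 θ)
    (α2 := fun θ => deriv j.t.c1 θ - deriv j.r.c1 θ - 2 * M * deriv j.r.c0 θ + 3 * j.θ.c2 θ)
    (α3 := 0) ((f12.sub e12).congr_left fun p => by simp; ring) hθ
  have c13 := fun θ hθ => coeff_eq_zero (n := 3) (θ := θ) (α0 := 0)
    (α1 := fun θ => Real.sin θ ^ 2 * (2 * M * a + 2 * j.φ.c1 θ))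
    (α2 := fun θ => Real.sin θ ^ 2 * (4 * M ^ 2 * a + 3 * j.φ.c2 θ))
    (α3 := 0) ((f13.sub e13).congr_left fun p => by simp; ring) hθ
  have r0 : ∀ θ ∈ Ioo 0 Real.pi, j.r.c0 θ = -(a ^ 2 / 2) * Real.sin θ ^ 2 := fun θ hθ => by
    linarith [(c11 θ hθ).2.2.1 (by norm_num)]
  have t1 : ∀ θ ∈ Ioo 0 Real.pi, j.t.c1 θ = M * a ^ 2 / 2 * (3 * Real.cos θ ^ 2 - 1) :=
    fun θ hθ => by
      have h1 := (c01 θ hθ).2.2.2 le_rfl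
      simp only [r0 θ hθ, Real.sin_sq] at h1
      linarith
  have r1 : ∀ θ ∈ Ioo 0 Real.pi, j.r.c1 θ = -(M * a ^ 2 / 2) * Real.sin θ ^ 2 := fun θ hθ => by
    have h1 := (c11 θ hθ).2.2.2 le_rfl
    simp only [r0 θ hθ, t1 θ hθ, Real.sin_sq] at h1 ⊢
    linarith
  have r0' := deriv_eq_on_Ioo r0 (hasDerivAt_mul_sin_sq _)
  have r1' := deriv_eq_on_Ioo r1 (hasDerivAt_mul_sin_sq _)
  have t1' := deriv_eq_on_Ioo t1 (hasDerivAt_mul_three_cos_sq_sub_one _)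
  intro θ hθ
  have h1 := (c12 θ hθ).2.1 (by norm_num)
  have h2 := (c12 θ hθ).2.2.1 le_rfl
  simp only [r0' θ hθ, r1' θ hθ, t1' θ hθ] at h1 h2
  have h3 := ((mul_eq_zero.1 ((c13 θ hθ).2.1 (by norm_num))).resolve_left (s0 θ hθ))
  have h4 := ((mul_eq_zero.1 ((c13 θ hθ).2.2.1 le_rfl)).resolve_left (s0 θ hθ))
  exact ⟨⟨t0 θ hθ, θ0 θ hθ, φ0 θ hθ⟩, r0 θ hθ, t1 θ hθ, by linarith, r1 θ hθ, by linarith,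
    by linarith, by linarith⟩

/-- `expansion` for coordinates with the Taylor coefficients of `Jets.IsBondiSachs`. -/
theorem Jets.IsBondiSachs.expansion {M a : ℝ} {j : Jets} (h : j.IsBondiSachs M a) :
    (fun p => j.gA M a p - (1 - 2 * M * p.1 +
      M * a ^ 2 * (3 * Real.cos p.2 ^ 2 - 1) * p.1 ^ 3)) =O[nearScri] (fun p => p.1 ^ 4) ∧
    (fun p => j.g01 M a p - 1) =O[nearScri] (fun p => p.1 ^ 4) ∧
    (fun p => j.g02 M a p - -(3 * M * a ^ 2 * (Real.sin p.2 * Real.cos p.2) * p.1 ^ 2))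
      =O[nearScri] (fun p => p.1 ^ 3) ∧
    (fun p => j.gB M a p - 2 * M * a * Real.sin p.2 ^ 2 * p.1) =O[nearScri] (fun p => p.1 ^ 3) ∧
    (fun p => j.g11 M a p) =O[nearScri] (fun p => p.1 ^ 4) ∧
    (fun p => j.g12 M a p) =O[nearScri] (fun p => p.1 ^ 3) ∧
    (fun p => j.g13 M a p) =O[nearScri] (fun p => p.1 ^ 3) ∧
    (fun p => j.g22 M a p - (-1 + M * a ^ 2 * Real.sin p.2 ^ 2 * p.1 ^ 3))
      =O[nearScri] (fun p => p.1 ^ 4) ∧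
    (fun p => j.g23 M a p) =O[nearScri] (fun p => p.1 ^ 4) ∧
    (fun p => j.gC M a p - (Real.sin p.2 ^ 2 + M * a ^ 2 * Real.sin p.2 ^ 4 * p.1 ^ 3))
      =O[nearScri] (fun p => p.1 ^ 4) := by
  have r0' := deriv_eq_on_Ioo (fun θ hθ => (h θ hθ).2.1) (hasDerivAt_mul_sin_sq _)
  have t1' := deriv_eq_on_Ioo (fun θ hθ => (h θ hθ).2.2.1) (hasDerivAt_mul_three_cos_sq_sub_one _)
  have θ1' := deriv_eq_on_Ioo (fun θ hθ => (h θ hθ).2.2.2.1) (hasDerivAt_mul_sin_mul_cos _)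
  have r1' := deriv_eq_on_Ioo (fun θ hθ => (h θ hθ).2.2.2.2.1) (hasDerivAt_mul_sin_sq _)
  have θ2' := deriv_eq_on_Ioo (fun θ hθ => (h θ hθ).2.2.2.2.2.1) (fun θ => hasDerivAt_const θ _)
  have φ1' := deriv_eq_on_Ioo (fun θ hθ => (h θ hθ).2.2.2.2.2.2.1) (fun θ => hasDerivAt_const θ _)
  have φ2' := deriv_eq_on_Ioo (fun θ hθ => (h θ hθ).2.2.2.2.2.2.2) (fun θ => hasDerivAt_const θ _)
  have hev : ∀ᶠ p in nearScri, p.2 ∈ Ioo 0 Real.pi :=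
    (eventually_nearScri one_pos).mono fun p hp => hp.2.2
  obtain ⟨e00, e01, e02, e03, e11, e12, e13, e22, e23, e33⟩ := KerrBS.expansion M a j
    (fun θ hθ => (h θ hθ).1.1) (fun θ hθ => (h θ hθ).1.2.1) (fun θ hθ => (h θ hθ).1.2.2)
  refine ⟨e00.congr' ?_ .rfl, e01.congr' ?_ .rfl, e02.congr' ?_ .rfl, e03, e11.congr' ?_ .rfl,
    e12.congr' ?_ .rfl, e13.congr' ?_ .rfl, e22.congr' ?_ .rfl, e23.congr' ?_ .rfl,
    e33.congr' ?_ .rfl⟩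
  all_goals
    filter_upwards [hev] with p hp
    obtain ⟨-, r0, t1, θ1, r1, θ2, φ1, φ2⟩ := h _ hp
    have hs : Real.cos p.2 ^ 2 = 1 - Real.sin p.2 ^ 2 := Real.cos_sq' _
    simp only [r0, t1, θ1, r1, θ2, φ1, φ2, r0' _ hp, t1' _ hp, θ1' _ hp, r1' _ hp, θ2' _ hp,
      φ1' _ hp, φ2' _ hp]
    generalize Real.sin p.2 = s at hs ⊢
    generalize Real.cos p.2 = c at hs ⊢
    grind

theorem Jets.IsBondiSachs.agreeToQuadrupole {M : ℝ} (hM : 0 < M) {a : ℝ} {j : Jets}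
    {c : Corrections} (hj : j.Represents c) (h : j.IsBondiSachs M a) :
    AgreeToQuadrupole (kerrIn M a c) (kerrQuadrupole M a) := by
  obtain ⟨e00, e01, e02, e03, e11, e12, e13, e22, e23, e33⟩ := h.expansion
  -- The entries of `kerrQuadrupole` in terms of `w`, with the angular block multiplied by `w ^ 2`.
  let H : Matrix (Fin 4) (Fin 4) (ℝ × ℝ → ℝ) :=
    !![fun p => 1 - 2 * M * p.1 + M * a ^ 2 * (3 * Real.cos p.2 ^ 2 - 1) * p.1 ^ 3, fun _ => 1,
        fun p => -(3 * M * a ^ 2 * (Real.sin p.2 * Real.cos p.2) * p.1 ^ 2),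
        fun p => 2 * M * a * Real.sin p.2 ^ 2 * p.1;
      fun _ => 1, fun _ => 0, fun _ => 0, fun _ => 0;
      fun p => -(3 * M * a ^ 2 * (Real.sin p.2 * Real.cos p.2) * p.1 ^ 2), fun _ => 0,
        fun p => -1 + M * a ^ 2 * Real.sin p.2 ^ 2 * p.1 ^ 3, fun _ => 0;
      fun p => 2 * M * a * Real.sin p.2 ^ 2 * p.1, fun _ => 0, fun _ => 0,
        fun p => -(Real.sin p.2 ^ 2 + M * a ^ 2 * Real.sin p.2 ^ 4 * p.1 ^ 3)]
  intro μ ν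
  refine (isO_kerrIn_sub_iff hM a hj _ μ ν (h := fun x => kerrQuadrupole M a x μ ν)
    (H := H μ ν) fun x hx _ => ?_).2 ?_
  · have hx' := hx.ne'
    fin_cases μ <;> fin_cases ν
    all_goals simp [H, scaling, kerrQuadrupole, Real.sin_two_mul]
    all_goals field_simp
    all_goals try ring
  · fin_cases μ <;> fin_cases ν
    exacts [e00, e01, e02, e03, e01, e11.congr_left fun p => (sub_zero _).symm,
      e12.congr_left fun p => (sub_zero _).symm, e13.congr_left fun p => (sub_zero _).symm, e02,
      e12.congr_left fun p => (sub_zero _).symm, e22, e23.congr_left fun p => (sub_zero _).symm,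
      e03, e13.congr_left fun p => (sub_zero _).symm, e23.congr_left fun p => (sub_zero _).symm,
      e33.neg_left.congr_left fun p => (neg_sub' _ _)]

theorem isApproxBondiSachsChart_of_isBondiSachs {M : ℝ} (hM : 0 < M) {a : ℝ} {j : Jets}
    (h : j.IsBondiSachs M a) : IsApproxBondiSachsChart M a j.corrections := by
  obtain ⟨-, e01, -, -, e11, e12, e13, -⟩ := h.expansion
  exact ⟨j.smoothAtScri, (isApproxBondiSachsForm_iff hM a j.represents_self).2 ⟨e01, e11, e12, e13⟩⟩

/-- The standard choice of approximate Bondi-Sachs coordinates. -/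
def bondiSachsJets (M a : ℝ) : Jets where
  t := ⟨fun _ => 0, fun θ => M * a ^ 2 / 2 * (3 * Real.cos θ ^ 2 - 1), fun _ => 0, fun _ => 0,
    fun _ => 0, by fun_prop, by fun_prop, by fun_prop, by fun_prop, by fun_prop⟩
  r := ⟨fun θ => -(a ^ 2 / 2) * Real.sin θ ^ 2, fun θ => -(M * a ^ 2 / 2) * Real.sin θ ^ 2,
    fun _ => 0, fun _ => 0, fun _ => 0, by fun_prop, by fun_prop, by fun_prop, by fun_prop,
    by fun_prop⟩
  θ := ⟨fun _ => 0, fun θ => -(a ^ 2 / 2) * (Real.sin θ * Real.cos θ), fun _ => 0, fun _ => 0,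
    fun _ => 0, by fun_prop, by fun_prop, by fun_prop, by fun_prop, by fun_prop⟩
  φ := ⟨fun _ => 0, fun _ => -(M * a), fun _ => -(4 / 3 * M ^ 2 * a), fun _ => 0,
    fun _ => 0, by fun_prop, by fun_prop, by fun_prop, by fun_prop, by fun_prop⟩

theorem isBondiSachs_bondiSachsJets (M a : ℝ) : (bondiSachsJets M a).IsBondiSachs M a :=
  fun _ _ => ⟨⟨rfl, rfl, rfl⟩, rfl, rfl, rfl, rfl, rfl, rfl, rfl⟩

theorem regularOnSphere_bondiSachsJets (M a : ℝ) :
    (bondiSachsJets M a).corrections.RegularOnSphere := by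
  intro w θ
  simp [Jets.corrections, bondiSachsJets, Jet.val]

/-! ### Quadrupole harmonics and uniqueness of the potentials. -/

theorem IsO.sub {n : ℕ} {f g : (Fin 4 → ℝ) → ℝ} (hf : IsO n f) (hg : IsO n g) :
    IsO n fun x => f x - g x := by
  obtain ⟨C, R, hR, h⟩ := hf
  obtain ⟨C', R', hR', h'⟩ := hg
  refine ⟨C + C', max R R', lt_max_of_lt_left hR, fun x hx hθ => ?_⟩
  have h1 := h x ((le_max_left _ _).trans hx) hθ
  have h2 := h' x ((le_max_right _ _).trans hx) hθ
  rw [add_mul]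
  exact (abs_sub _ _).trans (add_le_add h1 h2)

theorem IsO.congr {n : ℕ} {f g : (Fin 4 → ℝ) → ℝ} (hf : IsO n f)
    (h : ∀ x : Fin 4 → ℝ, 0 < x 1 → x 2 ∈ Ioo 0 Real.pi → f x = g x) : IsO n g := by
  obtain ⟨C, R, hR, hC⟩ := hf
  exact ⟨C, R, hR, fun x hx hθ => h x (hR.trans_le hx) hθ ▸ hC x hx hθ⟩

/-- Coefficients are compared along a ray with `θ`, `φ` fixed; `φ` stays free because arbitrary
potentials may depend on it. -/
theorem IsO.slice {n : ℕ} {f : (Fin 4 → ℝ) → ℝ} (hf : IsO n f) {θ : ℝ}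
    (hθ : θ ∈ Ioo 0 Real.pi) (φ : ℝ) :
    (fun w => f ![0, w⁻¹, θ, φ]) =O[𝓝[>] 0] fun w => w ^ n := by
  obtain ⟨C, R, hR, hC⟩ := hf
  refine IsBigO.of_bound C ?_
  filter_upwards [Ioo_mem_nhdsGT (inv_pos.2 hR)] with w hw
  have h := hC ![0, w⁻¹, θ, φ] (by simpa using (le_inv_comm₀ hR hw.1).2 hw.2.le) hθ
  simpa [abs_of_pos hw.1] using h

theorem IsQuadrupoleHarmonic.exists_coeff {f : ℝ → ℝ → ℝ} (hf : IsQuadrupoleHarmonic f) :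
    ∃ A B C D E : ℝ, ∀ θ φ, f θ φ =
      A * (Real.sin θ * Real.cos φ) ^ 2 + B * (Real.sin θ * Real.sin φ) ^ 2 -
      (A + B) * Real.cos θ ^ 2 + C * (Real.sin θ * Real.cos φ) * (Real.sin θ * Real.sin φ) +
      D * (Real.sin θ * Real.cos φ) * Real.cos θ + E * (Real.sin θ * Real.sin φ) * Real.cos θ := by
  obtain ⟨S, -, ht, h⟩ := hf
  refine ⟨S 0 0, S 1 1, S 0 1 + S 1 0, S 0 2 + S 2 0, S 1 2 + S 2 1, fun θ φ => ?_⟩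
  have h22 : S 2 2 = -(S 0 0 + S 1 1) := by
    rw [Matrix.trace_fin_three] at ht
    linarith
  rw [h]
  simp [Matrix.mulVec, dotProduct, Fin.sum_univ_three, h22]
  ring

/-- A quadrupole harmonic that is constant away from the poles vanishes. -/
theorem IsQuadrupoleHarmonic.eq_zero_of_const {f : ℝ → ℝ → ℝ} (hf : IsQuadrupoleHarmonic f)
    {k : ℝ} (hk : ∀ θ ∈ Ioo 0 Real.pi, ∀ φ, f θ φ = k) : ∀ θ φ, f θ φ = 0 := by
  obtain ⟨A, B, C, D, E, h⟩ := hf.exists_coeff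
  have hpi := Real.pi_pos
  have m2 : Real.pi / 2 ∈ Ioo 0 Real.pi := ⟨by linarith, by linarith⟩
  have m4 : Real.pi / 4 ∈ Ioo 0 Real.pi := ⟨by linarith, by linarith⟩
  have hsq : Real.sqrt 2 * Real.sqrt 2 = 2 := Real.mul_self_sqrt (by norm_num)
  -- On the equator `φ = 0, π/2, π/4` give `A = B = k` and `A + B + C = 2k`. At `θ = π/4`, `φ = 0,
  -- π` give `(-B ± D) / 2 = k`, hence `k = D = 0`, and `φ = π/2` gives `E = 0`.
  have e1 := hk _ m2 0
  have e2 := hk _ m2 (Real.pi / 2)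
  have e3 := hk _ m2 (Real.pi / 4)
  have e4 := hk _ m4 0
  have e5 := hk _ m4 Real.pi
  have e6 := hk _ m4 (Real.pi / 2)
  simp only [h, Real.sin_pi_div_two, Real.cos_pi_div_two, Real.sin_pi_div_four,
    Real.cos_pi_div_four, Real.sin_zero, Real.cos_zero, Real.sin_pi, Real.cos_pi] at e1 e2 e3 e4 e5 e6
  generalize Real.sqrt 2 = z at *
  have hA : A = 0 := by grind
  have hB : B = 0 := by grind
  have hC : C = 0 := by grind
  have hD : D = 0 := by grind
  have hE : E = 0 := by grind
  intro θ φ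
  rw [h, hA, hB, hC, hD, hE]
  ring

theorem IsQuadrupoleHarmonic.sub {f g : ℝ → ℝ → ℝ} (hf : IsQuadrupoleHarmonic f)
    (hg : IsQuadrupoleHarmonic g) : IsQuadrupoleHarmonic fun θ φ => f θ φ - g θ φ := by
  obtain ⟨S, hS, hS', h⟩ := hf
  obtain ⟨T, hT, hT', h'⟩ := hg
  refine ⟨S - T, hS.sub hT, by rw [Matrix.trace_sub, hS', hT', sub_zero], fun θ φ => ?_⟩
  simp only [h, h', Matrix.sub_mulVec, dotProduct_sub]

/-- The quadrupole potential of the Kerr metric. -/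
def kerrPotential (M a : ℝ) : ℝ → ℝ → ℝ :=
  fun θ _ => 1 / 6 * M * a ^ 2 * (3 * Real.cos θ ^ 2 - 1)

theorem isQuadrupoleHarmonic_kerrPotential (M a : ℝ) :
    IsQuadrupoleHarmonic (kerrPotential M a) := by
  -- On the unit sphere `3 cos²θ - 1 = 2z² - x² - y²`.
  refine ⟨Matrix.diagonal ![-(M * a ^ 2 / 6), -(M * a ^ 2 / 6), M * a ^ 2 / 3],
    Matrix.isSymm_diagonal _, ?_, fun θ φ => ?_⟩
  · simp [Matrix.trace_fin_three, Matrix.diagonal]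
    ring
  · have h1 : Real.sin φ ^ 2 = 1 - Real.cos φ ^ 2 := Real.sin_sq _
    have h2 : Real.sin θ ^ 2 = 1 - Real.cos θ ^ 2 := Real.sin_sq _
    simp [kerrPotential, Matrix.mulVec_diagonal, dotProduct, Fin.sum_univ_three]
    linear_combination (M * a ^ 2 / 6) * h2 + (M * a ^ 2 / 6) * Real.sin θ ^ 2 * h1

theorem isQuadrupoleHarmonic_zero : IsQuadrupoleHarmonic fun _ _ => 0 :=
  ⟨0, Matrix.isSymm_zero, Matrix.trace_zero _ _, by simp⟩

theorem pθ_kerrPotential (M a : ℝ) :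
    pθ (kerrPotential M a) = fun θ _ => -(M * a ^ 2) * (Real.sin θ * Real.cos θ) := by
  funext θ φ
  refine ((hasDerivAt_mul_three_cos_sq_sub_one (1 / 6 * M * a ^ 2) θ).congr_deriv ?_).deriv
  ring

theorem pφ_kerrPotential (M a : ℝ) : pφ (kerrPotential M a) = fun _ _ => 0 := by
  funext θ φ
  exact deriv_const _ _

/-- For a function of `θ` alone, `∇_AB Q` is `(Q'' - cot θ Q') / 2` times `diag(1, -sin²θ)`, and
here `Q'' - cot θ Q' = M a² sin²θ`. -/
theorem quadrupoleMetric_kerr (M a : ℝ) {x : Fin 4 → ℝ} (hx : 0 < x 1)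
    (hθ : x 2 ∈ Ioo 0 Real.pi) :
    quadrupoleMetric M (M * a) (kerrPotential M a) (fun _ _ => 0) x = kerrQuadrupole M a x := by
  have hs := (Real.sin_pos_of_mem_Ioo hθ).ne'
  have hx' := hx.ne'
  have e1 : pθ (fun θ _ => -(M * a ^ 2 * (Real.sin θ * Real.cos θ))) =
      fun θ _ => -(M * a ^ 2) * (Real.cos θ ^ 2 - Real.sin θ ^ 2) := by
    funext θ φ
    simp only [← neg_mul (M * a ^ 2)]
    exact (hasDerivAt_mul_sin_mul_cos _ θ).deriv
  have e2 : pθ (fun _ _ => 0) = fun _ _ => 0 := by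
    funext θ φ
    exact deriv_const _ _
  have e3 : pφ (fun _ _ => 0) = fun _ _ => 0 := by
    funext θ φ
    exact deriv_const _ _
  ext μ ν
  fin_cases μ <;> fin_cases ν
  all_goals
    simp [quadrupoleMetric, kerrQuadrupole, sphGrad, starGrad, sphTF, starTF, sphHess, sphLap,
      sphMetric, sphEta, pθ_kerrPotential, pφ_kerrPotential, e1, e2, e3, Real.sin_two_mul]
  · simp only [kerrPotential]
    field_simp
  · field_simp
  · exact .inl (by ring)
  · field_simp
  · field_simp
    ring
  · exact .inl (by ring)
  · field_simp
    ring

theorem IsQuadrupoleHarmonic.differentiable_left {f : ℝ → ℝ → ℝ} (hf : IsQuadrupoleHarmonic f)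
    (φ : ℝ) : Differentiable ℝ fun θ => f θ φ := by
  obtain ⟨A, B, C, D, E, h⟩ := hf.exists_coeff
  simp only [h]
  fun_prop

theorem IsQuadrupoleHarmonic.differentiable_right {f : ℝ → ℝ → ℝ} (hf : IsQuadrupoleHarmonic f)
    (θ : ℝ) : Differentiable ℝ fun φ => f θ φ := by
  obtain ⟨A, B, C, D, E, h⟩ := hf.exists_coeff
  simp only [h]
  fun_prop

/-- A vanishing gradient makes `f` constant off the poles, and there is no nonzero constant of
degree two. -/
theorem IsQuadrupoleHarmonic.eq_zero_of_sphGrad {f : ℝ → ℝ → ℝ} (hf : IsQuadrupoleHarmonic f)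
    (h1 : ∀ θ ∈ Ioo 0 Real.pi, ∀ φ, pθ f θ φ = 0) (h2 : ∀ θ ∈ Ioo 0 Real.pi, ∀ φ, pφ f θ φ = 0) :
    ∀ θ φ, f θ φ = 0 := by
  have hmem : Real.pi / 2 ∈ Ioo 0 Real.pi := ⟨by linarith [Real.pi_pos], by linarith [Real.pi_pos]⟩
  refine hf.eq_zero_of_const (k := f (Real.pi / 2) 0) fun θ hθ φ => ?_
  rw [is_const_of_deriv_eq_zero (hf.differentiable_right θ) (h2 θ hθ) φ 0]
  exact isOpen_Ioo.is_const_of_deriv_eq_zero isPreconnected_Ioo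
    (hf.differentiable_left 0).differentiableOn (fun z hz => h1 z hz 0) hθ hmem

theorem starGrad_eq (f : ℝ → ℝ → ℝ) (θ φ : ℝ) :
    starGrad f θ φ = ![(Real.sin θ)⁻¹ * pφ f θ φ, -(Real.sin θ * pθ f θ φ)] := by
  ext i
  fin_cases i <;> simp [starGrad, sphEta, sphGrad, Matrix.mulVec, dotProduct, Fin.sum_univ_two]

/-- Two metrics with quadrupole potentials that agree up to the quadrupole terms have the same
mass, angular momentum and potentials. -/
theorem quadrupole_unique {m J M L : ℝ} {Q P Q' : ℝ → ℝ → ℝ} (hQ : IsQuadrupoleHarmonic Q)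
    (hP : IsQuadrupoleHarmonic P) (hQ' : IsQuadrupoleHarmonic Q')
    (h : AgreeToQuadrupole (quadrupoleMetric m J Q P) (quadrupoleMetric M L Q' fun _ _ => 0)) :
    m = M ∧ J = L ∧ Q = Q' ∧ P = fun _ _ => 0 := by
  have hmem : Real.pi / 2 ∈ Ioo 0 Real.pi := ⟨by linarith [Real.pi_pos], by linarith [Real.pi_pos]⟩
  have hz1 : pθ (fun _ _ => 0) = fun _ _ => 0 := by
    funext θ φ
    exact deriv_const _ _
  have hz2 : pφ (fun _ _ => 0) = fun _ _ => 0 := by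
    funext θ φ
    exact deriv_const _ _
  have h00 : ∀ θ ∈ Ioo 0 Real.pi, ∀ φ, m = M ∧ Q θ φ = Q' θ φ := fun θ hθ φ => by
    have := IsO.slice (h 0 0) hθ φ
    obtain ⟨-, h1⟩ := eq_zero_of_isBigO_pow (α := 0) (n := 3)
      (g := fun w => 2 * (M - m) + w * (0 + w * (6 * (Q θ φ - Q' θ φ) + w * 0))) (by fun_prop)
      (this.congr_left fun w => by simp [quadrupoleMetric, div_eq_mul_inv]; ring)
    obtain ⟨e1, h2⟩ := eq_zero_of_isBigO_pow (by fun_prop) h1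
    obtain ⟨-, h3⟩ := eq_zero_of_isBigO_pow (by fun_prop) h2
    obtain ⟨e2, -⟩ := eq_zero_of_isBigO_pow (by fun_prop) h3
    exact ⟨by linarith, by linarith⟩
  obtain rfl : m = M := (h00 _ hmem 0).1
  obtain rfl : Q = Q' := by
    funext θ φ
    exact sub_eq_zero.1 ((hQ.sub hQ').eq_zero_of_const (k := 0)
      (fun θ hθ φ => sub_eq_zero.2 (h00 θ hθ φ).2) θ φ)
  -- The potentials `Q` are now identified, so `dQ` cancels in `g_0A` and only `*dP` remains, with
  -- components `∂_φ P / sin θ` and `-sin θ ∂_θ P`.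
  have h02 : ∀ θ ∈ Ioo 0 Real.pi, ∀ φ, pφ P θ φ = 0 := fun θ hθ φ => by
    have := IsO.slice (h 0 2) hθ φ
    obtain ⟨-, h1⟩ := eq_zero_of_isBigO_pow (α := 0) (n := 2)
      (g := fun w => 0 + w * (3 * ((Real.sin θ)⁻¹ * pφ P θ φ) + w * 0)) (by fun_prop)
      (this.congr_left fun w => by
        simp [quadrupoleMetric, div_eq_mul_inv, sphGrad, starGrad_eq, hz1, hz2]; ring)
    obtain ⟨-, h2⟩ := eq_zero_of_isBigO_pow (by fun_prop) h1
    obtain ⟨e, -⟩ := eq_zero_of_isBigO_pow (by fun_prop) h2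
    simpa [(Real.sin_pos_of_mem_Ioo hθ).ne'] using e
  have h03 : ∀ θ ∈ Ioo 0 Real.pi, ∀ φ, J = L ∧ pθ P θ φ = 0 := fun θ hθ φ => by
    have := IsO.slice (h 0 3) hθ φ
    obtain ⟨-, h1⟩ := eq_zero_of_isBigO_pow (α := 0) (n := 2)
      (g := fun w => 2 * (J - L) * Real.sin θ ^ 2 + w * (-3 * (Real.sin θ * pθ P θ φ) + w * 0))
      (by fun_prop) (this.congr_left fun w => by
        simp [quadrupoleMetric, div_eq_mul_inv, sphGrad, starGrad_eq, hz1, hz2]; ring)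
    obtain ⟨e1, h2⟩ := eq_zero_of_isBigO_pow (by fun_prop) h1
    obtain ⟨e2, -⟩ := eq_zero_of_isBigO_pow (by fun_prop) h2
    have hs := (Real.sin_pos_of_mem_Ioo hθ).ne'
    constructor
    · simpa [hs, sub_eq_zero] using e1
    · simpa [hs] using e2
  refine ⟨rfl, (h03 _ hmem 0).1, rfl, ?_⟩
  funext θ φ
  exact hP.eq_zero_of_sphGrad (fun θ hθ φ => (h03 θ hθ φ).2) h02 θ φ

/-- Two quadrupole metrics that agree with the same `g` agree with each other, so
`quadrupole_unique` applies. -/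
theorem hasQuadrupole_iff_of_agreeToQuadrupole {M a : ℝ}
    {g : (Fin 4 → ℝ) → Matrix (Fin 4) (Fin 4) ℝ} (hg : AgreeToQuadrupole g (kerrQuadrupole M a))
    (m J : ℝ) (Q P : ℝ → ℝ → ℝ) : HasQuadrupole g m J Q P ↔
      m = M ∧ J = M * a ∧ Q = kerrPotential M a ∧ P = fun _ _ => 0 := by
  have hk : AgreeToQuadrupole g
      (quadrupoleMetric M (M * a) (kerrPotential M a) fun _ _ => 0) := fun μ ν =>
    (hg μ ν).congr fun x hx hθ => by rw [quadrupoleMetric_kerr M a hx hθ]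
  constructor
  · rintro ⟨hQ, hP, h⟩
    refine quadrupole_unique hQ hP (isQuadrupoleHarmonic_kerrPotential M a) fun μ ν => ?_
    exact ((hk μ ν).sub (h μ ν)).congr fun x _ _ => by ring
  · rintro ⟨rfl, rfl, rfl, rfl⟩
    exact ⟨isQuadrupoleHarmonic_kerrPotential _ _, isQuadrupoleHarmonic_zero, hk⟩

end KerrBS

end

theorem mainTheorem5 (M a : ℝ) (hM : 0 < M) :
    (∃ c : KerrBS.Corrections, c.RegularOnSphere ∧ KerrBS.IsApproxBondiSachsChart M a c) ∧
    ∀ c : KerrBS.Corrections, KerrBS.IsApproxBondiSachsChart M a c →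
      KerrBS.AgreeToQuadrupole (KerrBS.kerrIn M a c) (KerrBS.kerrQuadrupole M a) ∧
      ∀ (m J : ℝ) (Q P : ℝ → ℝ → ℝ),
        KerrBS.HasQuadrupole (KerrBS.kerrIn M a c) m J Q P ↔
          m = M ∧ J = M * a ∧
          Q = (fun θ _ => 1 / 6 * M * a ^ 2 * (3 * Real.cos θ ^ 2 - 1)) ∧
          P = (fun _ _ => 0) := by
  refine ⟨⟨_, KerrBS.regularOnSphere_bondiSachsJets M a,
    KerrBS.isApproxBondiSachsChart_of_isBondiSachs hM (KerrBS.isBondiSachs_bondiSachsJets M a)⟩, ?_⟩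
  rintro c ⟨hc, hform⟩
  obtain ⟨j, hj⟩ := hc.exists_jets
  have hg := (KerrBS.isBondiSachs_of_isApproxBondiSachsForm hM a hj hform).agreeToQuadrupole hM hj
  exact ⟨hg, KerrBS.hasQuadrupole_iff_of_agreeToQuadrupole hg⟩
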